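/- A \emph{graph} is a finite undirected simple graph $G$ with vertex set $V(G)$, edge set $E(G)$ and a vertex colouring $\gamma^G : V(G)\to\Gamma$, where $\Gamma$ is a fixed finite set of colours. A homomorphism $F\to G$ is a map $h:V(F)\to V(G)$ with $h(u)h(v)\in E(G)$ for all $uv\in E(F)$ and $\gamma^F(u)=\gamma^G(h(u))$ for all $u\in V(F)$; $\hom(F,G)$ is the number of homomorphisms from $F$ to $G$. Graphs $G,G'$ are \emph{homomorphism-indistinguishable} over a class $\mathcal F$ of graphs if $\hom(F,G)=\hom(F,G')$ for all $F\in\mathcal F$. An \emph{elimination forest} of $G$ is a partial order $\preceq$ on $V(G)$ such that $\{u : u\preceq t\}$ is a chain for every $t\in V(G)$, and $u\preceq v$ or $v\preceq u$ for every edge $uv\in E(G)$; its height is the maximum number of elements of a chain. The \emph{tree depth} of $G$ is the minimum height of an elimination forest of $G$, and $\mathcal{TD}_k$ is the class of graphs of tree depth at most $k$. $\mathsf C$-formulas are built from the atomic formulas $x=y$, $E(x,y)$ and $\gamma(x)=c$ (for $c\in\Gamma$) by negation, disjunction and the counting quantifiers $\exists^{\ge p}x$ ("there are at least $p$ vertices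 $x$"), for $p\in\mathbb N$; the \emph{quantifier rank} is the maximum nesting depth of quantifiers, and a $\mathsf C_k$-sentence is a $\mathsf C$-formula without free variables of quantifier rank at most $k$. \textbf{Theorem.} Let $\Gamma$ be a finite set of colours. For all $k,d\ge 1$ there is a finite set $\mathcal F_{k,d}\subseteq\mathcal{TD}_k$ such that for all graphs $G,G'$ of maximum degree at most $d$ the following are equivalent: (i) $G$ and $G'$ are homomorphism-indistinguishable over $\mathcal F_{k,d}$; (ii) $G$ and $G'$ satisfy the same $\mathsf C_k$-sentences. Moreover, the sets $\mathcal F_{k,d}$ can be chosen to be computable from $k$ and $d$: there is an algorithm that, on input $(k,d)$, outputs a list of (explicit encodings of) the graphs in $\mathcal F_{k,d}$. -/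

import Mathlib

/-- An undirected graph with vertex set `V`, whose vertices are coloured by elements of `Γ`. -/
structure ColGraph (Γ : Type*) (V : Type*) where
  graph : SimpleGraph V
  color : V → Γ

namespace ColGraph

/-- Homomorphisms of coloured graphs: maps preserving adjacency and colours. -/
abbrev Hom {Γ V W : Type*} (F : ColGraph Γ W) (G : ColGraph Γ V) :=
  {h : F.graph →g G.graph // ∀ u, F.color u = G.color (h u)}

/-- The number `hom(F, G)` of homomorphisms (used for finite graphs only). -/
noncomputable def homCount {Γ V W : Type*} (F : ColGraph Γ W) (G : ColGraph Γ V) : ℕ :=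
  Nat.card (Hom F G)

/-- Every vertex of `G` has at most `d` neighbours. -/
def MaxDegreeLE {Γ V : Type*} (G : ColGraph Γ V) (d : ℕ) : Prop :=
  ∀ v, (G.graph.neighborSet v).encard ≤ (d : ℕ∞)

end ColGraph

/-- A partial order is a forest if the elements below any given element form a chain. -/
def IsForestOrder {V : Type*} (S : PartialOrder V) : Prop :=
  ∀ t, IsChain S.le {u | S.le u t}

/-- The height of a forest: the number of elements of a longest chain. -/
noncomputable def forestHeight {V : Type*} (S : PartialOrder V) : ℕ∞ :=
  ⨆ X ∈ {X : Set V | IsChain S.le X}, X.encard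

/-- `S` is an elimination forest of `G`: a forest order on the vertex set such that the ends of
every edge are comparable. -/
def IsElimForest {V : Type*} (G : SimpleGraph V) (S : PartialOrder V) : Prop :=
  IsForestOrder S ∧ ∀ u v, G.Adj u v → S.le u v ∨ S.le v u

/-- The tree depth of `G`: the minimum height of an elimination forest of `G`. -/
noncomputable def treeDepth {V : Type*} (G : SimpleGraph V) : ℕ∞ :=
  ⨅ S ∈ {S : PartialOrder V | IsElimForest G S}, forestHeight S

/-- Finite coloured graphs, represented (up to isomorphism) with vertex sets `Fin n`. -/
abbrev FinColGraph (Γ : Type*) := Σ n : ℕ, ColGraph Γ (Fin n)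

/-- The class of all finite coloured graphs of tree depth at most `k`. -/
def TD (Γ : Type*) (k : ℕ) : Set (FinColGraph Γ) :=
  {A | treeDepth A.2.graph ≤ (k : ℕ∞)}

/-- `G` and `G'` are homomorphism-indistinguishable over the class `𝓕`. -/
def HomIndistinguishable {Γ V V' : Type*} (𝓕 : Set (FinColGraph Γ))
    (G : ColGraph Γ V) (G' : ColGraph Γ V') : Prop :=
  ∀ A ∈ 𝓕, A.2.homCount G = A.2.homCount G'

/-- Formulas of first-order logic with counting quantifiers, in the language of `Γ`-coloured
graphs, whose free variables are among `x₀, …, xₙ₋₁`. The quantifier `atLeast p` binds the variable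
`xₙ` of its scope (which has free variables among `x₀, …, xₙ`). -/
inductive CFormula (Γ : Type*) : ℕ → Type _
  | eq {n : ℕ} (x y : Fin n) : CFormula Γ n
  | adj {n : ℕ} (x y : Fin n) : CFormula Γ n
  | hasColor {n : ℕ} (x : Fin n) (c : Γ) : CFormula Γ n
  | neg {n : ℕ} (φ : CFormula Γ n) : CFormula Γ n
  | or {n : ℕ} (φ ψ : CFormula Γ n) : CFormula Γ n
  | atLeast {n : ℕ} (p : ℕ) (φ : CFormula Γ (n + 1)) : CFormula Γ n

namespace CFormula

/-- Quantifier rank. -/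
def qr {Γ : Type*} : {n : ℕ} → CFormula Γ n → ℕ
  | _, eq _ _ => 0
  | _, adj _ _ => 0
  | _, hasColor _ _ => 0
  | _, neg φ => φ.qr
  | _, or φ ψ => max φ.qr ψ.qr
  | _, atLeast _ φ => φ.qr + 1

/-- Satisfaction of a formula in `G` under the assignment `a` of its free variables. -/
def Sat {Γ V : Type*} (G : ColGraph Γ V) : {n : ℕ} → CFormula Γ n → (Fin n → V) → Prop
  | _, eq x y, a => a x = a y
  | _, adj x y, a => G.graph.Adj (a x) (a y)
  | _, hasColor x c, a => G.color (a x) = c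
  | _, neg φ, a => ¬ φ.Sat G a
  | _, or φ ψ, a => φ.Sat G a ∨ ψ.Sat G a
  | n, atLeast p φ, a =>
      ∃ v : Fin p → V, Function.Injective v ∧ ∀ i, φ.Sat G (Fin.snoc (α := fun _ : Fin (n + 1) => V) a (v i))

end CFormula

/-- `G` and `G'` satisfy the same sentences of quantifier rank at most `k`. -/
def CEquiv {Γ V V' : Type*} (k : ℕ) (G : ColGraph Γ V) (G' : ColGraph Γ V') : Prop :=
  ∀ φ : CFormula Γ 0, φ.qr ≤ k → (φ.Sat G Fin.elim0 ↔ φ.Sat G' Fin.elim0)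

/-- Codes of finite coloured graphs: the list of the colours of the vertices `0, 1, …`, and a list
of edges. -/
abbrev GraphCode (Γ : Type*) := List Γ × List (ℕ × ℕ)

/-- The graph with a given code. Loops and pairs with an entry that is not a vertex are ignored,
and a pair stands for an undirected edge. -/
def GraphCode.decode {Γ : Type*} (C : GraphCode Γ) : FinColGraph Γ :=
  ⟨C.1.length,
    { graph := SimpleGraph.fromRel fun i j => ((i : ℕ), (j : ℕ)) ∈ C.2
      color := C.1.get }⟩

/-- The sets of graphs `𝓕 k d` are finite and uniformly computable: some algorithm outputs, on
input `k` and `d`, a list of codes of the graphs in `𝓕 k d`. -/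
def ComputableFamily {Γ : Type*} [Primcodable Γ] (𝓕 : ℕ → ℕ → Set (FinColGraph Γ)) : Prop :=
  ∃ L : ℕ → ℕ → List (GraphCode Γ), Computable₂ L ∧
    ∀ k d, 𝓕 k d = GraphCode.decode '' {C | C ∈ L k d}

/-! From (ii) to (i), the bijective counting game is played along an elimination forest. If two
tuples have the same rank-`(k+1)` type, some bijection of the vertex sets preserves the rank-`k`
types of the extended tuples (`exists_equiv_of_rankType_eq`). Splitting a graph at a minimal vertex
`r` of its forest turns its hom count into a sum over the images of `r`, times the count for the
part not above `r`. The bijection matches the summands, and the part above `r` has smaller height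
(`card_homs_eq_of_rankType_eq`).

For the converse, graphs with elimination forests are written as terms, whose values with prescribed
label images are hom counts. Gluing trees at their roots multiplies root contributions, so these
contributions span an algebra of functions on the disjoint union of the vertex sets. If all terms of
depth at most `k + 1` agree, every function in the algebra has equal sums over the two sides.
Interpolation puts the indicators of its joint level sets into the algebra, so corresponding level
sets have equal size, which again yields a game bijection (`exists_equiv_of_sum_eq`,
`TermEquiv.exists_equiv`).

Bounded degree makes finitely many terms suffice. A connected tree anchored at a label can only map
into a ball of bounded size, so its values are integers in some range `0, …, C` (`eval_le`). A
function with such values is annihilated by `X(X-1)⋯(X-C)`, so its high powers are combinations of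
lower ones. By induction on depth, every anchored connected term is a linear combination of terms of
bounded size (`pairEval_mem_span`). Closed terms are not anchored, but they are products of trees,
each handled separately below its root (`eval_eq_of_bounded`).

The size bound is primitive recursive. The family consists of all small codes whose edges join
ancestors to descendants in a forest given by a list of levels; this secures tree depth at most `k`
without any test, and every small term has such a code. -/

/-- The tuple `a` extended by `v`. -/
abbrev tupleSnoc {V : Type*} {n : ℕ} (a : Fin n → V) (v : V) : Fin (n + 1) → V :=
  Fin.snoc (α := fun _ : Fin (n + 1) => V) a v

theorem tupleSnoc_castSucc {V : Type*} {n : ℕ} (a : Fin n → V) (v : V) (i : Fin n) :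
    tupleSnoc a v i.castSucc = a i := by
  simp [tupleSnoc]

theorem tupleSnoc_last {V : Type*} {n : ℕ} (a : Fin n → V) (v : V) :
    tupleSnoc a v (Fin.last n) = v := by
  simp [tupleSnoc]

theorem tupleSnoc_comp_castSucc {V : Type*} {n : ℕ} (a : Fin n → V) (v : V) :
    tupleSnoc a v ∘ Fin.castSucc = a :=
  funext fun i => tupleSnoc_castSucc a v i

theorem comp_tupleSnoc_id {V : Type*} {n : ℕ} (a : Fin n → V) (i : Fin n) :
    a ∘ tupleSnoc id i = tupleSnoc a (a i) := by
  funext j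
  induction j using Fin.lastCases with
  | last => rw [Function.comp_apply, tupleSnoc_last, tupleSnoc_last]
  | cast j => rw [Function.comp_apply, tupleSnoc_castSucc, tupleSnoc_castSucc, id]

/-! ### Terms for graphs with elimination forests, and splitting them into connected trees -/

/-- Terms for coloured graphs with an elimination forest below a chain of `n` labels: a term is a
list of trees, and `cons c S t u` is the list whose first tree has a root of colour `c` that is
adjacent to the labels in `S`, with the trees of `t` hanging below it (with the root as additional
last label), and whose remaining trees are those of `u`. -/
inductive ElimTerm (Γ : Type*) : ℕ → Type _
  | nil {n : ℕ} : ElimTerm Γ n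
  | cons {n : ℕ} (c : Γ) (S : Finset (Fin n)) (t : ElimTerm Γ (n + 1)) (u : ElimTerm Γ n) :
      ElimTerm Γ n

namespace ElimTerm

variable {Γ V V' : Type*}

/-- `v` may serve as the image of a root of colour `c` adjacent to the labels in `S`. -/
def RootOK (G : ColGraph Γ V) {n : ℕ} (c : Γ) (S : Finset (Fin n)) (a : Fin n → V) (v : V) : Prop :=
  G.color v = c ∧ ∀ i ∈ S, G.graph.Adj v (a i)

noncomputable instance (G : ColGraph Γ V) {n : ℕ} (c : Γ) (S : Finset (Fin n)) (a : Fin n → V) :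
    DecidablePred (RootOK G c S a) := Classical.decPred _

/-- The number of homomorphisms from the graph of a term that map the labels to `a`. -/
noncomputable def eval [Fintype V] (G : ColGraph Γ V) : {n : ℕ} → ElimTerm Γ n → (Fin n → V) → ℕ
  | _, nil, _ => 1
  | _, cons c S t u, a =>
      (∑ v, if RootOK G c S a v then t.eval G (tupleSnoc a v) else 0) * u.eval G a

/-- The height of the elimination forest. -/
def depth : {n : ℕ} → ElimTerm Γ n → ℕ
  | _, nil => 0
  | _, cons _ _ t u => max (t.depth + 1) u.depth

/-- The number of vertices without the labels. -/
def size : {n : ℕ} → ElimTerm Γ n → ℕ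
  | _, nil => 0
  | _, cons _ _ t u => t.size + u.size + 1

/-- Concatenation of lists of trees. -/
def append : {n : ℕ} → ElimTerm Γ n → ElimTerm Γ n → ElimTerm Γ n
  | _, nil, w => w
  | _, cons c S t u, w => cons c S t (u.append w)

/-- The extension of a renaming of labels to one more label. -/
def liftMap {n m : ℕ} (r : Fin n → Fin m) : Fin (n + 1) → Fin (m + 1) :=
  tupleSnoc (fun i => (r i).castSucc) (Fin.last m)

/-- Renaming of labels. -/
def rename : {n m : ℕ} → (Fin n → Fin m) → ElimTerm Γ n → ElimTerm Γ m
  | _, _, _, nil => nil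
  | _, _, r, cons c S t u => cons c (S.image r) (t.rename (liftMap r)) (u.rename r)

/-- Some vertex is adjacent to the label `i`. -/
def Mentions : {n : ℕ} → Fin n → ElimTerm Γ n → Prop
  | _, _, nil => False
  | _, i, cons _ S t u => (i ∈ S ∨ t.Mentions i.castSucc) ∨ u.Mentions i

/-- Every tree has a vertex adjacent to the label `j`. -/
def AllMention : {n : ℕ} → Fin n → ElimTerm Γ n → Prop
  | _, _, nil => True
  | _, j, cons _ S t u => (j ∈ S ∨ t.Mentions j.castSucc) ∧ u.AllMention j

/-- Every tree below a root has a vertex adjacent to this root: all trees are connected. -/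
def Conn : {n : ℕ} → ElimTerm Γ n → Prop
  | _, nil => True
  | n, cons _ _ t u => (t.Conn ∧ t.AllMention (Fin.last n)) ∧ u.Conn

theorem Mentions.cons_iff {n : ℕ} {i : Fin n} {c : Γ} {S : Finset (Fin n)} {t u} :
    (cons c S t u).Mentions i ↔ (i ∈ S ∨ t.Mentions i.castSucc) ∨ u.Mentions i := Iff.rfl

section append

theorem eval_append [Fintype V] (G : ColGraph Γ V) {n : ℕ} (t u : ElimTerm Γ n) (a : Fin n → V) :
    (t.append u).eval G a = t.eval G a * u.eval G a := by
  induction t with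
  | nil => simp [append, eval]
  | cons c S t w _ ih => simp only [append, eval, ih, mul_assoc]

theorem depth_append {n : ℕ} (t u : ElimTerm Γ n) :
    (t.append u).depth = max t.depth u.depth := by
  induction t with
  | nil => simp [append, depth]
  | cons c S t w _ ih => simp only [append, depth, ih, max_assoc]

theorem size_append {n : ℕ} (t u : ElimTerm Γ n) : (t.append u).size = t.size + u.size := by
  induction t with
  | nil => simp [append, size]
  | cons c S t w _ ih => simp only [append, size, ih]; omega

theorem mentions_append {n : ℕ} (t u : ElimTerm Γ n) (i : Fin n) :
    (t.append u).Mentions i ↔ t.Mentions i ∨ u.Mentions i := by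
  induction t with
  | nil => simp [append, Mentions]
  | cons c S t w _ ih => simp only [append, Mentions, ih, or_assoc]

theorem allMention_append {n : ℕ} (t u : ElimTerm Γ n) (i : Fin n) :
    (t.append u).AllMention i ↔ t.AllMention i ∧ u.AllMention i := by
  induction t with
  | nil => simp [append, AllMention]
  | cons c S t w _ ih => simp only [append, AllMention, ih, and_assoc]

theorem conn_append {n : ℕ} (t u : ElimTerm Γ n) :
    (t.append u).Conn ↔ t.Conn ∧ u.Conn := by
  induction t with
  | nil => simp [append, Conn]
  | cons c S t w _ ih => simp only [append, Conn, ih, and_assoc]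

end append

section rename

theorem liftMap_castSucc {n m : ℕ} (r : Fin n → Fin m) (i : Fin n) :
    liftMap r i.castSucc = (r i).castSucc := by
  simp [liftMap, tupleSnoc]

theorem liftMap_last {n m : ℕ} (r : Fin n → Fin m) :
    liftMap r (Fin.last n) = Fin.last m := by
  simp [liftMap, tupleSnoc]

theorem tupleSnoc_comp_liftMap {n m : ℕ} (r : Fin n → Fin m) (a : Fin m → V) (v : V) :
    tupleSnoc a v ∘ liftMap r = tupleSnoc (a ∘ r) v := by
  funext i
  induction i using Fin.lastCases with
  | last => simp only [Function.comp_apply, liftMap_last, tupleSnoc_last]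
  | cast i => simp only [Function.comp_apply, liftMap_castSucc, tupleSnoc_castSucc]

theorem liftMap_injective {n m : ℕ} {r : Fin n → Fin m} (hr : Function.Injective r) :
    Function.Injective (liftMap r) := by
  intro i j
  induction i using Fin.lastCases with
  | last =>
    induction j using Fin.lastCases with
    | last => simp
    | cast j => simp only [liftMap_last, liftMap_castSucc]; intro h; exact absurd h.symm (Fin.castSucc_ne_last _)
  | cast i =>
    induction j using Fin.lastCases with
    | last => simp only [liftMap_last, liftMap_castSucc]; intro h; exact absurd h (Fin.castSucc_ne_last _)
    | cast j =>
      simp only [liftMap_castSucc]; intro h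
      rw [hr (Fin.castSucc_injective _ h)]

theorem eval_rename [Fintype V] (G : ColGraph Γ V) {n m : ℕ} (r : Fin n → Fin m)
    (t : ElimTerm Γ n) (a : Fin m → V) : (t.rename r).eval G a = t.eval G (a ∘ r) := by
  induction t generalizing m with
  | nil => simp [rename, eval]
  | cons c S t u iht ihu =>
    have h : ∀ v, RootOK G c (S.image r) a v ↔ RootOK G c S (a ∘ r) v := by simp [RootOK]
    simp only [rename, eval, iht, ihu, tupleSnoc_comp_liftMap, h]

theorem depth_rename {n m : ℕ} (r : Fin n → Fin m) (t : ElimTerm Γ n) :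
    (t.rename r).depth = t.depth := by
  induction t generalizing m with
  | nil => rfl
  | cons c S t u iht ihu => simp only [rename, depth, iht, ihu]

theorem mentions_rename {n m : ℕ} {r : Fin n → Fin m} (hr : Function.Injective r)
    (t : ElimTerm Γ n) (i : Fin n) : (t.rename r).Mentions (r i) ↔ t.Mentions i := by
  induction t generalizing m with
  | nil => rfl
  | cons c S t u iht ihu =>
    simp only [rename, Mentions, ihu hr, ← liftMap_castSucc, iht (liftMap_injective hr),
      Finset.mem_image, hr.eq_iff, exists_eq_right]

theorem allMention_rename {n m : ℕ} {r : Fin n → Fin m} (hr : Function.Injective r)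
    (t : ElimTerm Γ n) (i : Fin n) : (t.rename r).AllMention (r i) ↔ t.AllMention i := by
  induction t with
  | nil => rfl
  | cons c S t u _ ihu =>
    simp only [rename, AllMention, ihu hr, ← liftMap_castSucc,
      mentions_rename (liftMap_injective hr), Finset.mem_image, hr.eq_iff, exists_eq_right]

theorem conn_rename {n m : ℕ} {r : Fin n → Fin m} (hr : Function.Injective r)
    (t : ElimTerm Γ n) : (t.rename r).Conn ↔ t.Conn := by
  induction t generalizing m with
  | nil => rfl
  | cons c S t u iht ihu =>
    simp only [rename, Conn, ihu hr, iht (liftMap_injective hr), ← liftMap_last r,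
      allMention_rename (liftMap_injective hr)]

theorem exists_rename_eq {n m : ℕ} (r : Fin n → Fin m) (t : ElimTerm Γ m)
    (h : ∀ i, t.Mentions i → i ∈ Set.range r) : ∃ u : ElimTerm Γ n, u.rename r = t := by
  induction t generalizing n with
  | nil => exact ⟨nil, rfl⟩
  | cons c S t u iht ihu =>
    obtain ⟨t', ht'⟩ := iht (liftMap r) fun i hi => by
      induction i using Fin.lastCases with
      | last => exact ⟨_, liftMap_last r⟩
      | cast i =>
        obtain ⟨j, rfl⟩ := h i (Or.inl (Or.inr hi))
        exact ⟨_, liftMap_castSucc r j⟩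
    obtain ⟨u', hu'⟩ := ihu r fun i hi => h i (Or.inr hi)
    have hS : (↑S : Set (Fin _)) ⊆ r '' Set.univ := by
      intro i hi
      rw [Set.image_univ]
      exact h i (Or.inl (Or.inl hi))
    obtain ⟨S', -, hS'⟩ := Finset.subset_set_image_iff.1 hS
    exact ⟨cons c S' t' u', by simp only [rename, hu', ht', hS']⟩

end rename

/-- The trees that do not mention the label `j` can be split off. -/
theorem exists_split [Fintype V] [Fintype V'] (G : ColGraph Γ V) (G' : ColGraph Γ V')
    {n m : ℕ} (r : Fin n → Fin m) (hr : Function.Injective r) (j : Fin m)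
    (hj : ∀ i, i ≠ j → i ∈ Set.range r) (t : ElimTerm Γ m) (ht : t.Conn) :
    ∃ (p : ElimTerm Γ m) (q : ElimTerm Γ n), p.Conn ∧ q.Conn ∧ p.AllMention j ∧
      p.depth ≤ t.depth ∧ q.depth ≤ t.depth ∧
      (∀ a, t.eval G a = p.eval G a * q.eval G (a ∘ r)) ∧
      (∀ a, t.eval G' a = p.eval G' a * q.eval G' (a ∘ r)) := by
  induction t with
  | nil => exact ⟨nil, nil, by simp [Conn, AllMention, depth, eval]⟩
  | cons c S t u _ ihu =>
    obtain ⟨p, q, hp, hq, hpm, hpd, hqd, hG, hG'⟩ := ihu r hr j hj ht.2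
    by_cases hlast : j ∈ S ∨ t.Mentions j.castSucc
    · refine ⟨cons c S t p, q, ⟨ht.1, hp⟩, hq, ⟨hlast, hpm⟩, ?_, ?_, ?_, ?_⟩
      · simp only [depth]; omega
      · simp only [depth]; omega
      · intro a; simp only [eval, hG, mul_assoc]
      · intro a; simp only [eval, hG', mul_assoc]
    -- The first tree does not mention `j`, so it is the renaming of a term without that label and
    -- can join `q`.
    · obtain ⟨w, hw⟩ := exists_rename_eq r (cons c S t nil) fun i hi => hj i <| by
        rintro rfl
        exact hi.elim hlast id
      have hwc : w.Conn := by
        rw [← conn_rename hr, hw]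
        exact ⟨ht.1, trivial⟩
      refine ⟨p, w.append q, hp, (conn_append _ _).2 ⟨hwc, hq⟩, hpm, ?_, ?_, ?_, ?_⟩
      · simp only [depth]; omega
      · rw [depth_append, ← depth_rename r w, hw]; simp only [depth]; omega
      · intro a
        rw [eval_append, ← eval_rename G r w, hw]
        simp only [eval, hG]; ring
      · intro a
        rw [eval_append, ← eval_rename G' r w, hw]
        simp only [eval, hG']; ring

/-- Every term has the same values as a term whose trees are all connected. -/
theorem exists_conn [Fintype V] [Fintype V'] (G : ColGraph Γ V) (G' : ColGraph Γ V')
    {n : ℕ} (t : ElimTerm Γ n) :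
    ∃ p : ElimTerm Γ n, p.Conn ∧ p.depth ≤ t.depth ∧
      (∀ a, t.eval G a = p.eval G a) ∧ (∀ a, t.eval G' a = p.eval G' a) := by
  induction t with
  | nil => exact ⟨nil, by simp [Conn]⟩
  | cons c S t u iht ihu =>
    obtain ⟨t', htc, htd, htG, htG'⟩ := iht
    obtain ⟨u', huc, hud, huG, huG'⟩ := ihu
    obtain ⟨p, q, hp, hq, hpm, hpd, hqd, hG, hG'⟩ := exists_split G G' Fin.castSucc
      (Fin.castSucc_injective _) (Fin.last _) (fun i hi => Fin.exists_castSucc_eq.2 hi) t' htc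
    refine ⟨cons c S p (q.append u'), ⟨⟨hp, hpm⟩, (conn_append _ _).2 ⟨hq, huc⟩⟩, ?_, ?_, ?_⟩
    · simp only [depth, depth_append]; omega
    -- The split-off factor does not see the root, so it is constant in the summation variable and
    -- leaves the sum.
    · intro a
      simp only [eval, eval_append, htG, huG, hG, tupleSnoc_comp_castSucc, ← mul_assoc, ← ite_zero_mul,
        ← Finset.sum_mul]
    · intro a
      simp only [eval, eval_append, htG', huG', hG', tupleSnoc_comp_castSucc, ← mul_assoc, ← ite_zero_mul,
        ← Finset.sum_mul]

end ElimTerm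

/-! ### Counting logic and the bijective game -/

namespace CFormula

variable {Γ V V' : Type*}

theorem sat_atLeast_iff [Fintype V] (G : ColGraph Γ V) {n : ℕ} (p : ℕ) (φ : CFormula Γ (n + 1))
    (a : Fin n → V) :
    (atLeast p φ).Sat G a ↔ p ≤ Nat.card {v // φ.Sat G (tupleSnoc a v)} := by
  classical
  rw [Nat.card_eq_fintype_card]
  constructor
  · rintro ⟨v, hv, h⟩
    simpa using Fintype.card_le_of_injective (fun i => (⟨v i, h i⟩ : {v // φ.Sat G (tupleSnoc a v)}))
      fun i j hij => hv (congrArg Subtype.val hij)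
  · intro h
    obtain ⟨f⟩ := Function.Embedding.nonempty_of_card_le
      (α := Fin p) (β := {v // φ.Sat G (tupleSnoc a v)}) (by simpa using h)
    exact ⟨fun i => f i, fun i j hij => f.injective (Subtype.ext hij), fun i => (f i).2⟩

/-- The formulas of quantifier rank at most `k` satisfied by `a`. -/
def rankType (G : ColGraph Γ V) (k : ℕ) {n : ℕ} (a : Fin n → V) : Set (CFormula Γ n) :=
  {φ | φ.qr ≤ k ∧ φ.Sat G a}

theorem rankType_eq_iff {G : ColGraph Γ V} {G' : ColGraph Γ V'} {k n : ℕ} {a : Fin n → V}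
    {a' : Fin n → V'} :
    rankType G k a = rankType G' k a' ↔ ∀ φ : CFormula Γ n, φ.qr ≤ k → (φ.Sat G a ↔ φ.Sat G' a') := by
  simp only [rankType, Set.ext_iff, Set.mem_ofPred_eq, and_congr_right_iff]

/-- Only finitely many points have to be told apart, so one separating formula per point of a
different type suffices: take the negation of their disjunction, with `neg (eq 0 0)` as the empty
disjunction. Leaving `sat` abstract allows `W` to be the disjoint union of two vertex sets, so that
one formula isolates a type in both graphs. -/
theorem exists_isolating {W : Type*} [Finite W] {n : ℕ} (k : ℕ)
    (sat : W → CFormula Γ (n + 1) → Prop) (hneg : ∀ w φ, sat w (neg φ) ↔ ¬ sat w φ)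
    (hor : ∀ w φ ψ, sat w (or φ ψ) ↔ sat w φ ∨ sat w ψ) (heq : ∀ w, sat w (eq 0 0)) (w₀ : W) :
    ∃ χ : CFormula Γ (n + 1), χ.qr ≤ k ∧
      ∀ w, sat w χ ↔ {φ | φ.qr ≤ k ∧ sat w φ} = {φ | φ.qr ≤ k ∧ sat w₀ φ} := by
  classical
  have := Fintype.ofFinite W
  have hsep : ∀ w, {φ | φ.qr ≤ k ∧ sat w φ} ≠ {φ | φ.qr ≤ k ∧ sat w₀ φ} →
      ∃ φ : CFormula Γ (n + 1), φ.qr ≤ k ∧ ¬ sat w₀ φ ∧ sat w φ := by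
    intro w hw
    by_contra! hcon
    refine hw (Set.ext fun φ => and_congr_right fun hφ => ⟨fun h => ?_, fun h => ?_⟩)
    · by_contra h0
      exact hcon φ hφ h0 h
    · by_contra h0
      exact hcon (neg φ) hφ (by rwa [hneg, not_not]) ((hneg _ _).2 h0)
  have main : ∀ s : Finset W, ∃ φ : CFormula Γ (n + 1), φ.qr ≤ k ∧ ¬ sat w₀ φ ∧
      ∀ w ∈ s, {φ | φ.qr ≤ k ∧ sat w φ} ≠ {φ | φ.qr ≤ k ∧ sat w₀ φ} → sat w φ := by
    intro s
    induction s using Finset.induction_on with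
    | empty => exact ⟨neg (eq 0 0), Nat.zero_le _, by simp [hneg, heq], by simp⟩
    | insert w s _ ih =>
      obtain ⟨φ, h1, h2, h3⟩ := ih
      by_cases hw : {φ | φ.qr ≤ k ∧ sat w φ} = {φ | φ.qr ≤ k ∧ sat w₀ φ}
      · exact ⟨φ, h1, h2, by simpa [hw] using h3⟩
      · obtain ⟨ψ, g1, g2, g3⟩ := hsep w hw
        refine ⟨or φ ψ, max_le h1 g1, by simp [hor, h2, g2], fun x hx hxw => ?_⟩
        rcases Finset.mem_insert.1 hx with rfl | hx
        · exact (hor _ _ _).2 (Or.inr g3)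
        · exact (hor _ _ _).2 (Or.inl (h3 x hx hxw))
  obtain ⟨φ, h1, h2, h3⟩ := main Finset.univ
  refine ⟨neg φ, h1, fun w => ⟨fun h => ?_, fun h => ?_⟩⟩
  · by_contra hw
    exact (hneg _ _).1 h (h3 w (Finset.mem_univ _) hw)
  · exact (h.ge (show neg φ ∈ _ from ⟨h1, (hneg _ _).2 h2⟩)).2

/-- Duplicator's answer in one round of the bijective game. -/
theorem exists_equiv_of_rankType_eq [Fintype V] [Fintype V'] {G : ColGraph Γ V}
    {G' : ColGraph Γ V'} {k n : ℕ} {a : Fin n → V} {a' : Fin n → V'}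
    (h : rankType G (k + 1) a = rankType G' (k + 1) a') :
    ∃ e : V ≃ V', ∀ v, rankType G k (tupleSnoc a v) = rankType G' k (tupleSnoc a' (e v)) := by
  have key : ∀ T : Set (CFormula Γ (n + 1)),
      Nonempty ({v // rankType G k (tupleSnoc a v) = T} ≃
        {v // rankType G' k (tupleSnoc a' v) = T}) := by
    intro T
    let sat : V ⊕ V' → CFormula Γ (n + 1) → Prop := Sum.elim
      (fun v φ => φ.Sat G (tupleSnoc a v)) fun v φ => φ.Sat G' (tupleSnoc a' v)
    by_cases hT : ∃ w, {φ | φ.qr ≤ k ∧ sat w φ} = T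
    · obtain ⟨w, rfl⟩ := hT
      obtain ⟨χ, hχ, h1⟩ := exists_isolating k sat (by rintro (v | v) φ <;> exact Iff.rfl)
        (by rintro (v | v) φ ψ <;> exact Iff.rfl) (by rintro (v | v) <;> exact rfl) w
      -- The sentences `atLeast p χ`, for all `p`, pin down the number of realisations of the type.
      have hp : ∀ p, p ≤ Nat.card {v // χ.Sat G (tupleSnoc a v)} ↔
          p ≤ Nat.card {v // χ.Sat G' (tupleSnoc a' v)} := by
        intro p
        rw [← sat_atLeast_iff, ← sat_atLeast_iff]
        exact rankType_eq_iff.1 h (atLeast p χ) (Nat.succ_le_succ hχ)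
      have hc := le_antisymm ((hp _).1 le_rfl) ((hp _).2 le_rfl)
      exact ⟨(Equiv.subtypeEquivRight fun v => (h1 (Sum.inl v)).symm).trans
        ((Finite.card_eq.1 hc).some.trans
          (Equiv.subtypeEquivRight fun v => h1 (Sum.inr v)))⟩
    · rw [not_exists, Sum.forall] at hT
      have h₁ : IsEmpty {v // rankType G k (tupleSnoc a v) = T} := ⟨fun v => hT.1 _ v.2⟩
      have h₂ : IsEmpty {v // rankType G' k (tupleSnoc a' v) = T} := ⟨fun v => hT.2 _ v.2⟩
      exact ⟨Equiv.equivOfIsEmpty _ _⟩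
  refine ⟨Equiv.ofFiberEquiv (f := fun v => rankType G k (tupleSnoc a v))
    (g := fun v => rankType G' k (tupleSnoc a' v)) fun T => (key T).some, fun v => ?_⟩
  exact (Equiv.ofFiberEquiv_map (fun T => (key T).some) v).symm

end CFormula

/-! ### Equivalence in the logic implies equal homomorphism counts -/

/-- A coloured graph whose vertices may be adjacent to `n` labels outside. -/
structure LabelledGraph (Γ : Type*) (n : ℕ) (W : Type*) extends ColGraph Γ W where
  labels : W → Finset (Fin n)

namespace LabelledGraph

open ElimTerm

variable {Γ V V' W W' W₁ W₂ : Type*} {n : ℕ}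

/-- Homomorphisms that map the labels to `a`. -/
abbrev Homs (F : LabelledGraph Γ n W) (G : ColGraph Γ V) (a : Fin n → V) :=
  {h : W → V // (∀ w, RootOK G (F.color w) (F.labels w) a (h w)) ∧
    ∀ u w, F.graph.Adj u w → G.graph.Adj (h u) (h w)}

/-- Adjacency in `LabelledGraph.cons`. -/
def consAdj (F₁ : LabelledGraph Γ (n + 1) W₁) (F₂ : LabelledGraph Γ n W₂) :
    Option (W₁ ⊕ W₂) → Option (W₁ ⊕ W₂) → Prop
  | none, some (Sum.inl w) => Fin.last n ∈ F₁.labels w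
  | some (Sum.inl w), none => Fin.last n ∈ F₁.labels w
  | some (Sum.inl u), some (Sum.inl w) => F₁.graph.Adj u w
  | some (Sum.inr u), some (Sum.inr w) => F₂.graph.Adj u w
  | _, _ => False

/-- The disjoint union of `F₂` and the graph obtained from `F₁` by making its last label a vertex of
colour `c` adjacent to the labels in `S`. -/
def cons (c : Γ) (S : Finset (Fin n)) (F₁ : LabelledGraph Γ (n + 1) W₁)
    (F₂ : LabelledGraph Γ n W₂) : LabelledGraph Γ n (Option (W₁ ⊕ W₂)) where
  graph :=
    { Adj := consAdj F₁ F₂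
      symm := ⟨by
        rintro (_ | u | u) (_ | w | w) h
        all_goals first | exact h | exact SimpleGraph.Adj.symm (G := F₁.graph) h |
          exact SimpleGraph.Adj.symm (G := F₂.graph) h⟩
      loopless := ⟨by
        rintro (_ | u | u) h
        all_goals first | exact h | exact F₁.graph.loopless.irrefl _ h |
          exact F₂.graph.loopless.irrefl _ h⟩ }
  color := fun w => w.elim c (Sum.elim F₁.color F₂.color)
  labels := fun w => w.elim S
    (Sum.elim (fun w => Finset.univ.filter fun i => i.castSucc ∈ F₁.labels w) F₂.labels)

theorem rootOK_tupleSnoc {G : ColGraph Γ V} {c : Γ} {S : Finset (Fin (n + 1))} {a : Fin n → V}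
    {x v : V} : RootOK G c S (tupleSnoc a x) v ↔
      RootOK G c (Finset.univ.filter fun i => i.castSucc ∈ S) a v ∧
        (Fin.last n ∈ S → G.graph.Adj v x) := by
  simp only [RootOK, Fin.forall_fin_succ', tupleSnoc_castSucc, tupleSnoc_last, Finset.mem_filter,
    Finset.mem_univ, true_and, and_assoc]

/-- A homomorphism from `cons c S F₁ F₂` splits into its parts. -/
def homsConsEquiv (c : Γ) (S : Finset (Fin n)) (F₁ : LabelledGraph Γ (n + 1) W₁)
    (F₂ : LabelledGraph Γ n W₂) (G : ColGraph Γ V) (a : Fin n → V) :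
    (cons c S F₁ F₂).Homs G a ≃
      (Σ v : {v // RootOK G c S a v}, F₁.Homs G (tupleSnoc a v)) × F₂.Homs G a where
  toFun h :=
    ⟨⟨⟨h.1 none, h.2.1 none⟩, ⟨fun w => h.1 (some (Sum.inl w)),
      fun w => rootOK_tupleSnoc.2 ⟨h.2.1 (some (Sum.inl w)), fun hw => h.2.2 (some (Sum.inl w)) none hw⟩,
      fun u w huw => h.2.2 (some (Sum.inl u)) (some (Sum.inl w)) huw⟩⟩,
     ⟨fun w => h.1 (some (Sum.inr w)), fun w => h.2.1 (some (Sum.inr w)),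
      fun u w huw => h.2.2 (some (Sum.inr u)) (some (Sum.inr w)) huw⟩⟩
  invFun p :=
    ⟨fun w => w.elim p.1.1.1 (Sum.elim p.1.2.1 p.2.1), by
      rintro (_ | w | w)
      · exact p.1.1.2
      · exact (rootOK_tupleSnoc.1 (p.1.2.2.1 w)).1
      · exact p.2.2.1 w, by
      rintro (_ | u | u) (_ | w | w) h
      · exact h.elim
      · exact ((rootOK_tupleSnoc.1 (p.1.2.2.1 w)).2 h).symm
      · exact h.elim
      · exact (rootOK_tupleSnoc.1 (p.1.2.2.1 u)).2 h
      · exact p.1.2.2.2 u w h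
      · exact h.elim
      · exact h.elim
      · exact h.elim
      · exact p.2.2.2 u w h⟩
  left_inv h := Subtype.ext <| funext <| by rintro (_ | w | w) <;> rfl
  right_inv p := rfl

/-- This is the recursion that defines `ElimTerm.eval`. It serves both to unfold a graph along its
forest and to build the graph of a term. -/
theorem card_homs_cons [Fintype V] [Finite W₁] [Finite W₂] (c : Γ) (S : Finset (Fin n))
    (F₁ : LabelledGraph Γ (n + 1) W₁) (F₂ : LabelledGraph Γ n W₂) (G : ColGraph Γ V)
    (a : Fin n → V) :
    Nat.card ((cons c S F₁ F₂).Homs G a) =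
      (∑ v, if RootOK G c S a v then Nat.card (F₁.Homs G (tupleSnoc a v)) else 0) *
        Nat.card (F₂.Homs G a) := by
  rw [Nat.card_congr (homsConsEquiv c S F₁ F₂ G a), Nat.card_prod, Nat.card_sigma,
    ← Finset.sum_filter]
  congr 1
  exact (Finset.sum_subtype _ (by simp) fun v => Nat.card (F₁.Homs G (tupleSnoc a v))).symm

theorem card_homs_congr {F : LabelledGraph Γ n W} {F' : LabelledGraph Γ n W'} (e : W ≃ W')
    (hc : ∀ w, F'.color (e w) = F.color w) (hl : ∀ w, F'.labels (e w) = F.labels w)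
    (ha : ∀ u w, F'.graph.Adj (e u) (e w) ↔ F.graph.Adj u w) (G : ColGraph Γ V) (a : Fin n → V) :
    Nat.card (F.Homs G a) = Nat.card (F'.Homs G a) := by
  refine (Nat.card_congr ((e.arrowCongr (Equiv.refl V)).subtypeEquiv fun h => ?_))
  refine and_congr ?_ ?_
  · rw [← e.forall_congr_right]
    simp [hc, hl]
  · rw [← e.forall_congr_right]
    refine forall_congr' fun u => ?_
    rw [← e.forall_congr_right]
    simp [ha]

theorem card_homs_of_isEmpty [IsEmpty W] (F : LabelledGraph Γ n W) (G : ColGraph Γ V)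
    (a : Fin n → V) : Nat.card (F.Homs G a) = 1 := by
  have : Unique (F.Homs G a) :=
    { default := ⟨isEmptyElim, isEmptyElim, fun u => isEmptyElim u⟩
      uniq := fun h => Subtype.ext (funext isEmptyElim) }
  exact Nat.card_unique

theorem rootOK_iff_of_rankType_eq {G : ColGraph Γ V} {G' : ColGraph Γ V'} {k : ℕ} {a : Fin n → V}
    {a' : Fin n → V'} {v : V} {v' : V'}
    (h : CFormula.rankType G k (tupleSnoc a v) = CFormula.rankType G' k (tupleSnoc a' v'))
    (c : Γ) (S : Finset (Fin n)) : RootOK G c S a v ↔ RootOK G' c S a' v' := by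
  have h1 := CFormula.rankType_eq_iff.1 h (.hasColor (Fin.last n) c) (Nat.zero_le _)
  have h2 := fun i : Fin n =>
    CFormula.rankType_eq_iff.1 h (.adj (Fin.last n) i.castSucc) (Nat.zero_le _)
  simp only [CFormula.Sat, tupleSnoc_last, tupleSnoc_castSucc] at h1 h2
  simp only [RootOK, h1, h2]

open Classical in
/-- The part of a graph above `r`, with `r` as additional label. -/
noncomputable def above [PartialOrder W] (F : LabelledGraph Γ n W) (r : W) :
    LabelledGraph Γ (n + 1) {w : W // r < w} where
  graph := F.graph.comap Subtype.val
  color := fun w => F.color w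
  labels := fun w => (F.labels w).map Fin.castSuccEmb ∪
    if F.graph.Adj w r then {Fin.last n} else ∅

/-- The part of a graph not above `r`. -/
def notAbove [PartialOrder W] (F : LabelledGraph Γ n W) (r : W) :
    LabelledGraph Γ n {w : W // ¬ r ≤ w} where
  graph := F.graph.comap Subtype.val
  color := fun w => F.color w
  labels := fun w => F.labels w

/-- A partial order consists of an element, those above it and the others. -/
noncomputable def optionSumEquiv [PartialOrder W] (r : W) :
    Option ({w : W // r < w} ⊕ {w : W // ¬ r ≤ w}) ≃ W :=
  Equiv.ofBijective (fun o => o.elim r (Sum.elim Subtype.val Subtype.val)) (by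
    constructor
    · rintro (_ | u | u) (_ | w | w) h
      · rfl
      · exact absurd h w.2.ne
      · exact absurd h.le w.2
      · exact absurd h u.2.ne'
      · exact congrArg (fun x => some (Sum.inl x)) (Subtype.ext h)
      · exact absurd (u.2.le.trans h.le) w.2
      · exact absurd h.ge u.2
      · exact absurd (w.2.le.trans h.ge) u.2
      · exact congrArg (fun x => some (Sum.inr x)) (Subtype.ext h)
    · intro w
      by_cases h : r ≤ w
      · rcases h.eq_or_lt with rfl | h
        · exact ⟨none, rfl⟩
        · exact ⟨some (Sum.inl ⟨w, h⟩), rfl⟩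
      · exact ⟨some (Sum.inr ⟨w, h⟩), rfl⟩)

/-- No edge joins the part above `r` to the part not above `r`: its ends would be comparable, and
the forest property together with the minimality of `r` would put both above `r`. Hence the graph is
the `cons` of its two parts. -/
theorem card_homs_eq_sum [PartialOrder W] [Finite W] [Fintype V] (F : LabelledGraph Γ n W) (r : W)
    (hr : ∀ w, ¬ w < r) (hfor : ∀ t : W, IsChain (· ≤ ·) {u | u ≤ t})
    (hadj : ∀ u w, F.graph.Adj u w → u ≤ w ∨ w ≤ u) (G : ColGraph Γ V) (a : Fin n → V) :
    Nat.card (F.Homs G a) =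
      (∑ v, if RootOK G (F.color r) (F.labels r) a v then
          Nat.card ((F.above r).Homs G (tupleSnoc a v)) else 0) *
        Nat.card ((F.notAbove r).Homs G a) := by
  classical
  have hlast : ∀ w, Fin.last n ∈ (F.above r).labels w ↔ F.graph.Adj w r := by
    intro w
    by_cases h : F.graph.Adj w r <;> simp [above, h]
  have hcast : ∀ w i, Fin.castSucc i ∈ (F.above r).labels w ↔ i ∈ F.labels w := by
    intro w i
    by_cases h : F.graph.Adj w r <;> simp [above, h]
  have hcross : ∀ (u : {w : W // r < w}) (w : {w : W // ¬ r ≤ w}), ¬ F.graph.Adj u w := by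
    intro u w h
    rcases hadj _ _ h with h | h
    · exact w.2 (u.2.le.trans h)
    · rcases hfor u h u.2.le (fun h => w.2 h.ge) with h | h
      · exact hr w (lt_of_le_of_ne h fun h => w.2 h.ge)
      · exact w.2 h
  have hroot : ∀ w : {w : W // ¬ r ≤ w}, ¬ F.graph.Adj r w := by
    intro w h
    rcases hadj _ _ h with h | h
    · exact w.2 h
    · exact hr w (lt_of_le_of_ne h fun h => w.2 h.ge)
  rw [← card_homs_cons]
  refine (card_homs_congr (optionSumEquiv r) ?_ ?_ ?_ G a).symm
  · rintro (_ | w | w) <;> rfl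
  · rintro (_ | w | w)
    · rfl
    · ext i
      exact (hcast w i).symm.trans (by simp [cons])
    · rfl
  · rintro (_ | u | u) (_ | w | w)
    · exact iff_of_false (F.graph.irrefl) id
    · exact (F.graph.adj_comm _ _).trans (hlast w).symm
    · exact iff_of_false (hroot w) id
    · exact (hlast u).symm
    · exact Iff.rfl
    · exact iff_of_false (hcross u w) id
    · exact iff_of_false (fun h => hroot u h.symm) id
    · exact iff_of_false (fun h => hcross w u h.symm) id
    · exact Iff.rfl

/-- Duplicator's strategy in the bijective game preserves the numbers of homomorphisms from graphs
with an elimination forest of height at most the number of rounds. -/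
theorem card_homs_eq_of_rankType_eq [Finite V] [Finite V'] {G : ColGraph Γ V} {G' : ColGraph Γ V'}
    (N : ℕ) : ∀ (W : Type) [Finite W] [PartialOrder W], Nat.card W ≤ N →
      ∀ (n : ℕ) (F : LabelledGraph Γ n W) (k : ℕ),
        (∀ X : Set W, IsChain (· ≤ ·) X → X.encard ≤ k) →
        (∀ t : W, IsChain (· ≤ ·) {u | u ≤ t}) →
        (∀ u w, F.graph.Adj u w → u ≤ w ∨ w ≤ u) →
        ∀ (a : Fin n → V) (a' : Fin n → V'),
          CFormula.rankType G k a = CFormula.rankType G' k a' →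
          Nat.card (F.Homs G a) = Nat.card (F.Homs G' a') := by
  have := Fintype.ofFinite V
  have := Fintype.ofFinite V'
  induction N with
  | zero =>
    intro W _ _ hW n F k _ _ _ a a' _
    have : IsEmpty W := Finite.card_eq_zero_iff.1 (Nat.le_zero.1 hW)
    rw [card_homs_of_isEmpty, card_homs_of_isEmpty]
  | succ N ih =>
    intro W _ _ hW n F k hht hfor hadj a a' hrank
    rcases isEmpty_or_nonempty W with hE | hne
    · rw [card_homs_of_isEmpty, card_homs_of_isEmpty]
    obtain ⟨r, -, hr⟩ := WellFounded.has_min (wellFounded_lt (α := W)) Set.univ Set.univ_nonempty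
    replace hr : ∀ w, ¬ w < r := fun w => hr w trivial
    -- The chain `{r}` shows that the height bound is positive, so there is a round left to play.
    obtain ⟨k, rfl⟩ : ∃ k', k = k' + 1 := by
      refine Nat.exists_eq_succ_of_ne_zero ?_
      rintro rfl
      simpa using hht {r} (Set.subsingleton_singleton.isChain)
    have hcard := Nat.card_congr (optionSumEquiv r)
    rw [Finite.card_option, Nat.card_sum] at hcard
    have hval : ∀ {p : W → Prop} (X : Set {w // p w}), (Subtype.val '' X).encard = X.encard :=
      fun X => Subtype.val_injective.encard_image X
    have hchain : ∀ {p : W → Prop} (X : Set {w // p w}), IsChain (· ≤ ·) X →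
        IsChain (· ≤ ·) (Subtype.val '' X) := by
      rintro p X hX _ ⟨u, hu, rfl⟩ _ ⟨w, hw, rfl⟩ huw
      exact hX hu hw fun h => huw (congrArg _ h)
    have hsub : ∀ {p : W → Prop} (t : {w // p w}), IsChain (· ≤ ·) {u | u ≤ t} :=
      fun t u hu w hw huw => hfor t hu hw fun h => huw (Subtype.ext h)
    obtain ⟨e, he⟩ := CFormula.exists_equiv_of_rankType_eq hrank
    rw [card_homs_eq_sum F r hr hfor hadj, card_homs_eq_sum F r hr hfor hadj]
    congr 1
    · refine Fintype.sum_equiv e _ _ fun v => ?_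
      refine if_congr (rootOK_iff_of_rankType_eq (he v) _ _) ?_ rfl
      refine ih _ (by omega) _ (F.above r) k (fun X hX => ?_) hsub (fun u w h => hadj _ _ h) _ _ (he v)
      -- A chain above `r` becomes longer by one when `r` is added, so the height of this part drops
      -- by one, as does the number of rounds.
      have h1 := hht (insert r (Subtype.val '' X)) ((hchain X hX).insert (by
        rintro _ ⟨w, -, rfl⟩ -
        exact Or.inl w.2.le))
      rw [Set.encard_insert_of_notMem (by rintro ⟨w, -, hw⟩; exact w.2.ne' hw), hval] at h1
      push_cast at h1
      exact (ENat.add_le_add_iff_right ENat.one_ne_top).1 h1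
    · exact ih _ (by omega) _ (F.notAbove r) (k + 1) (fun X hX => hval X ▸ hht _ (hchain X hX)) hsub
        (fun u w h => hadj _ _ h) _ _ hrank

/-- A graph without labels. -/
def ofColGraph (F : ColGraph Γ W) : LabelledGraph Γ 0 W where
  toColGraph := F
  labels := fun _ => ∅

theorem card_homs_ofColGraph (F : ColGraph Γ W) (G : ColGraph Γ V) (a : Fin 0 → V) :
    Nat.card ((ofColGraph F).Homs G a) = F.homCount G :=
  Nat.card_congr
    { toFun := fun h => ⟨⟨h.1, fun {u w} => h.2.2 u w⟩, fun u => (h.2.1 u).1.symm⟩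
      invFun := fun h => ⟨h.1, fun w => ⟨(h.2 w).symm, fun i => i.elim0⟩, fun _ _ huw => h.1.map_rel huw⟩
      left_inv := fun _ => rfl
      right_inv := fun _ => rfl }

end LabelledGraph

theorem CEquiv.homIndistinguishable {Γ V V' : Type*} [Finite V] [Finite V'] {k : ℕ}
    {G : ColGraph Γ V} {G' : ColGraph Γ V'} (h : CEquiv k G G') :
    HomIndistinguishable (TD Γ k) G G' := by
  rintro ⟨n, F⟩ hF
  -- A forest of height at most `k` exists: otherwise all heights, and with them their infimum,
  -- would be at least `k + 1`.
  obtain ⟨S, hS, hk⟩ : ∃ S, IsElimForest F.graph S ∧ forestHeight S ≤ k := by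
    by_contra! hcon
    have : ((k + 1 : ℕ) : ℕ∞) ≤ treeDepth F.graph :=
      le_iInf₂ fun S hS => by simpa using Order.add_one_le_of_lt (hcon S hS)
    have h2 : ((k + 1 : ℕ) : ℕ∞) ≤ k := this.trans hF
    exact absurd (Nat.cast_le.1 h2) (by omega)
  rw [← LabelledGraph.card_homs_ofColGraph F G Fin.elim0,
    ← LabelledGraph.card_homs_ofColGraph F G' Fin.elim0]
  let := S
  refine LabelledGraph.card_homs_eq_of_rankType_eq n (Fin n) (by simp) 0 _ k (fun X hX => ?_) hS.1
    hS.2 _ _ (CFormula.rankType_eq_iff.2 h)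
  exact (le_iSup₂_of_le X hX le_rfl : X.encard ≤ forestHeight S).trans hk

/-! ### Equal term values imply equivalence in the logic -/

/-- The indicator of each joint level set of `A` belongs to `A`; the sum condition for it says that
the level set has as many points in `V` as in `V'`. Bijections between these fibres are then put
together. -/
theorem exists_equiv_of_sum_eq {V V' : Type*} [Fintype V] [Fintype V']
    (A : Subalgebra ℚ (V ⊕ V' → ℚ)) (hA : ∀ g ∈ A, ∑ v, g (Sum.inl v) = ∑ v, g (Sum.inr v)) :
    ∃ e : V ≃ V', ∀ g ∈ A, ∀ v, g (Sum.inl v) = g (Sum.inr (e v)) := by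
  classical
  let τ : V ⊕ V' → A → ℚ := fun w g => g.1 w
  have hind : ∀ w₀, (fun w => if τ w = τ w₀ then (1 : ℚ) else 0) ∈ A := by
    intro w₀
    have hsep : ∀ w, ∃ g ∈ A, τ w ≠ τ w₀ → g w ≠ g w₀ := by
      intro w
      by_cases hw : τ w = τ w₀
      · exact ⟨1, A.one_mem, fun h => absurd hw h⟩
      · obtain ⟨g, hg⟩ := Function.ne_iff.1 hw
        exact ⟨g, g.2, fun _ => hg⟩
    choose g hgA hg using hsep
    -- Interpolation: the factor for `w` vanishes at `w` and equals `1` on the level set of `w₀`.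
    have hprod : (∏ w ∈ Finset.univ.filter fun w => τ w ≠ τ w₀,
        (g w - algebraMap ℚ _ (g w w)) * algebraMap ℚ _ ((g w w₀ - g w w)⁻¹)) ∈ A :=
      A.prod_mem fun w _ => A.mul_mem (A.sub_mem (hgA w) (A.algebraMap_mem _)) (A.algebraMap_mem _)
    convert hprod using 1
    funext x
    rw [Finset.prod_apply]
    split_ifs with hx
    · refine (Finset.prod_eq_one fun w hw => ?_).symm
      have h1 : g w x = g w w₀ := congrFun hx ⟨g w, hgA w⟩
      have h2 := hg w (Finset.mem_filter.1 hw).2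
      simp only [Pi.mul_apply, Pi.sub_apply, Pi.algebraMap_apply, Algebra.algebraMap_self,
        RingHom.id_apply, h1]
      exact mul_inv_cancel₀ (sub_ne_zero.2 h2.symm)
    · refine (Finset.prod_eq_zero (i := x) (by simpa using hx) ?_).symm
      simp
  have key : ∀ c : A → ℚ, Nonempty ({v // τ (Sum.inl v) = c} ≃ {v // τ (Sum.inr v) = c}) := by
    intro c
    by_cases hc : ∃ w, τ w = c
    · obtain ⟨w, rfl⟩ := hc
      have h := hA _ (hind w)
      simp only [Finset.sum_boole, Nat.cast_inj] at h
      exact ⟨Fintype.equivOfCardEq (by rw [Fintype.card_subtype, Fintype.card_subtype, h])⟩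
    · rw [not_exists, Sum.forall] at hc
      have h₁ : IsEmpty {v // τ (Sum.inl v) = c} := ⟨fun v => hc.1 _ v.2⟩
      have h₂ : IsEmpty {v // τ (Sum.inr v) = c} := ⟨fun v => hc.2 _ v.2⟩
      exact ⟨Equiv.equivOfIsEmpty _ _⟩
  refine ⟨Equiv.ofFiberEquiv (f := fun v => τ (Sum.inl v)) (g := fun v => τ (Sum.inr v))
    fun c => (key c).some, fun g hg v => ?_⟩
  exact congrFun (Equiv.ofFiberEquiv_map (fun c => (key c).some) v).symm ⟨g, hg⟩

/-- A bijection that respects some types can be chosen to respect given tuples as well. -/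
theorem exists_equiv_apply_eq {V V' T : Type*} {n : ℕ} (τ : V → T) (τ' : V' → T)
    (a : Fin n → V) (a' : Fin n → V') (heq : ∀ i j, a i = a j ↔ a' i = a' j)
    (hτ : ∀ i, τ (a i) = τ' (a' i)) (e : V ≃ V') (he : ∀ v, τ v = τ' (e v)) :
    ∃ e : V ≃ V', (∀ v, τ v = τ' (e v)) ∧ ∀ i, e (a i) = a' i := by
  classical
  suffices h : ∀ s : Finset (Fin n), ∃ e : V ≃ V', (∀ v, τ v = τ' (e v)) ∧ ∀ i ∈ s, e (a i) = a' i by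
    simpa using h Finset.univ
  intro s
  induction s using Finset.induction_on with
  | empty => exact ⟨e, he, by simp⟩
  | insert i s _ ih =>
    obtain ⟨f, hf, hs⟩ := ih
    -- The swapped points have the same type, and entries treated earlier stay in place because both
    -- tuples have the same equality pattern.
    refine ⟨f.trans (Equiv.swap (f (a i)) (a' i)), fun v => ?_, fun j hj => ?_⟩
    · rw [Equiv.trans_apply, hf v]
      by_cases h1 : f v = f (a i)
      · rw [h1, Equiv.swap_apply_left, ← hτ, ← hf]
      · by_cases h2 : f v = a' i
        · rw [h2, Equiv.swap_apply_right, ← hτ, ← hf]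
        · rw [Equiv.swap_apply_of_ne_of_ne h1 h2]
    · rcases Finset.mem_insert.1 hj with rfl | hj
      · simp
      · rw [Equiv.trans_apply]
        by_cases h1 : a j = a i
        · rw [h1, Equiv.swap_apply_left, (heq j i).1 h1]
        · rw [Equiv.swap_apply_of_ne_of_ne (fun h => h1 (f.injective h)), hs j hj]
          rw [hs j hj]
          exact fun h => h1 ((heq j i).2 h)

namespace ElimTerm

variable {Γ V V' : Type*} [Fintype V] [Fintype V']

/-- The tuples `a` and `a'` have the same atomic type, and the terms of depth at most `k` have the
same values for them. -/
structure TermEquiv (G : ColGraph Γ V) (G' : ColGraph Γ V') (k : ℕ) {n : ℕ} (a : Fin n → V)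
    (a' : Fin n → V') : Prop where
  eq_iff : ∀ i j, a i = a j ↔ a' i = a' j
  adj_iff : ∀ i j, G.graph.Adj (a i) (a j) ↔ G'.graph.Adj (a' i) (a' j)
  color_eq : ∀ i, G.color (a i) = G'.color (a' i)
  eval_eq : ∀ t : ElimTerm Γ n, t.depth ≤ k → t.eval G a = t.eval G' a'

/-- The contribution of `v` to the value of a tree. -/
noncomputable def rootEval (G : ColGraph Γ V) {n : ℕ} (a : Fin n → V) (c : Γ) (S : Finset (Fin n))
    (t : ElimTerm Γ (n + 1)) (v : V) : ℕ :=
  if RootOK G c S a v then t.eval G (tupleSnoc a v) else 0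

/-- Gluing two trees at roots of the same colour does not increase the depth; this makes the span of
the root contributions closed under products. -/
theorem rootEval_mul (G : ColGraph Γ V) {n : ℕ} (a : Fin n → V) (c : Γ) (S S' : Finset (Fin n))
    (t t' : ElimTerm Γ (n + 1)) (v : V) :
    rootEval G a c S t v * rootEval G a c S' t' v = rootEval G a c (S ∪ S') (t.append t') v := by
  have h : RootOK G c (S ∪ S') a v ↔ RootOK G c S a v ∧ RootOK G c S' a v := by
    simp only [RootOK, Finset.mem_union, or_imp, forall_and]
    tauto
  simp only [rootEval, eval_append, h]
  by_cases h1 : RootOK G c S a v <;> by_cases h2 : RootOK G c S' a v <;> simp [h1, h2]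

theorem rootEval_mul_of_ne (G : ColGraph Γ V) {n : ℕ} (a : Fin n → V) {c c' : Γ} (hc : c ≠ c')
    (S S' : Finset (Fin n)) (t t' : ElimTerm Γ (n + 1)) (v : V) :
    rootEval G a c S t v * rootEval G a c' S' t' v = 0 := by
  simp only [rootEval]
  by_cases h1 : RootOK G c S a v
  · rw [if_neg (show ¬ RootOK G c' S' a v from fun h2 => hc (h1.1.symm.trans h2.1)), mul_zero]
  · rw [if_neg h1, zero_mul]

theorem rootEval_pos_iff (G : ColGraph Γ V) {n : ℕ} (a : Fin n → V) (c : Γ) (S : Finset (Fin n))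
    (v : V) : rootEval G a c S nil v = 1 ↔ RootOK G c S a v := by
  by_cases h : RootOK G c S a v <;> simp [rootEval, h, eval]

theorem eval_cons_nil (G : ColGraph Γ V) {n : ℕ} (a : Fin n → V) (c : Γ) (S : Finset (Fin n))
    (t : ElimTerm Γ (n + 1)) :
    (cons c S t nil).eval G a = ∑ v, rootEval G a c S t v := by
  simp [eval, rootEval]

variable {G : ColGraph Γ V} {G' : ColGraph Γ V'}

/-- The root contributions, as functions on `V ⊕ V'`, span a unital algebra. Their sums over either
side are values of terms one level deeper, where the hypothesis applies. -/
theorem exists_equiv_rootEval [Finite Γ] {k n : ℕ} {a : Fin n → V} {a' : Fin n → V'}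
    (h : TermEquiv G G' (k + 1) a a') :
    ∃ e : V ≃ V', ∀ c S (t : ElimTerm Γ (n + 1)), t.depth ≤ k →
      ∀ v, rootEval G a c S t v = rootEval G' a' c S t (e v) := by
  classical
  have := Fintype.ofFinite Γ
  let g : Γ → Finset (Fin n) → ElimTerm Γ (n + 1) → V ⊕ V' → ℚ := fun c S t =>
    Sum.elim (fun v => (rootEval G a c S t v : ℚ)) fun v => (rootEval G' a' c S t v : ℚ)
  let s : Set (V ⊕ V' → ℚ) := {f | ∃ c S t, depth t ≤ k ∧ f = g c S t}
  have hs : ∀ c S t, depth t ≤ k → g c S t ∈ Submodule.span ℚ s := fun c S t ht =>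
    Submodule.subset_span ⟨c, S, t, ht, rfl⟩
  have hone : (1 : V ⊕ V' → ℚ) ∈ Submodule.span ℚ s := by
    -- Each vertex has exactly one colour, and there are finitely many colours.
    have : (1 : V ⊕ V' → ℚ) = ∑ c, g c ∅ nil := by
      funext w
      rcases w with w | w <;> simp [g, Finset.sum_apply, rootEval, RootOK, eval]
    rw [this]
    exact Submodule.sum_mem _ fun c _ => hs _ _ _ (Nat.zero_le _)
  have hmul : ∀ f f', f ∈ Submodule.span ℚ s → f' ∈ Submodule.span ℚ s →
      f * f' ∈ Submodule.span ℚ s := by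
    intro f f' hf hf'
    refine Submodule.span_mul_span ℚ s s ▸ Submodule.mul_mem_mul hf hf' |> fun h => ?_
    refine Submodule.span_le.2 ?_ h
    rintro _ ⟨_, ⟨c, S, t, ht, rfl⟩, _, ⟨c', S', t', ht', rfl⟩, rfl⟩
    by_cases hc : c = c'
    · subst hc
      have : g c S t * g c S' t' = g c (S ∪ S') (t.append t') := by
        funext w
        rcases w with w | w <;> simp only [g, Pi.mul_apply, Sum.elim_inl, Sum.elim_inr,
          ← rootEval_mul, Nat.cast_mul]
      simp only [this]
      exact hs _ _ _ (by rw [depth_append]; exact max_le ht ht')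
    · have : g c S t * g c' S' t' = 0 := by
        funext w
        rcases w with w | w <;> simp only [g, Pi.mul_apply, Sum.elim_inl, Sum.elim_inr,
          ← Nat.cast_mul, rootEval_mul_of_ne _ _ hc, Nat.cast_zero, Pi.zero_apply]
      simp only [this]
      exact Submodule.zero_mem _
  obtain ⟨e, he⟩ := exists_equiv_of_sum_eq ((Submodule.span ℚ s).toSubalgebra hone hmul) (by
    intro f hf
    rw [Submodule.mem_toSubalgebra] at hf
    induction hf using Submodule.span_induction with
    | mem f hf =>
      obtain ⟨c, S, t, ht, rfl⟩ := hf
      have := h.eval_eq (cons c S t nil) (by simp only [depth]; omega)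
      rw [eval_cons_nil, eval_cons_nil] at this
      simpa only [g, Sum.elim_inl, Sum.elim_inr, ← Nat.cast_sum, Nat.cast_inj] using this
    | zero => simp
    | add f f' _ _ h1 h2 => simp only [Pi.add_apply, Finset.sum_add_distrib, h1, h2]
    | smul r f _ h1 => simp only [Pi.smul_apply, ← Finset.smul_sum, h1])
  refine ⟨e, fun c S t ht v => ?_⟩
  have := he (g c S t) (hs c S t ht) v
  simpa only [g, Sum.elim_inl, Sum.elim_inr, Nat.cast_inj] using this

/-- A bijection preserving root contributions need not map `a i` to `a' i`, as the equality atoms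
require. These points have the same contributions, so the bijection can be corrected. -/
theorem TermEquiv.exists_equiv [Finite Γ] {k n : ℕ} {a : Fin n → V} {a' : Fin n → V'}
    (h : TermEquiv G G' (k + 1) a a') :
    ∃ e : V ≃ V', ∀ v, TermEquiv G G' k (tupleSnoc a v) (tupleSnoc a' (e v)) := by
  obtain ⟨e₀, he₀⟩ := exists_equiv_rootEval h
  obtain ⟨e, he, hea⟩ := exists_equiv_apply_eq
    (fun v (p : Γ × Finset (Fin n) × {t : ElimTerm Γ (n + 1) // t.depth ≤ k}) =>
      rootEval G a p.1 p.2.1 p.2.2 v)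
    (fun v p => rootEval G' a' p.1 p.2.1 p.2.2 v) a a' h.eq_iff (fun i => funext fun p => by
      have h1 : RootOK G p.1 p.2.1 a (a i) ↔ RootOK G' p.1 p.2.1 a' (a' i) := by
        simp only [RootOK, h.color_eq, h.adj_iff]
      -- Identifying the extra label with label `i` keeps the depth and leaves a term in the old
      -- labels.
      have h3 := h.eval_eq (p.2.2.1.rename (tupleSnoc id i)) (by
        rw [depth_rename]; exact p.2.2.2.trans (Nat.le_succ _))
      rw [eval_rename, eval_rename, comp_tupleSnoc_id, comp_tupleSnoc_id] at h3
      simp only [rootEval, h1, h3]) e₀ (fun v => funext fun p => he₀ _ _ _ p.2.2.2 v)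
  replace he : ∀ c S (t : ElimTerm Γ (n + 1)), t.depth ≤ k →
      ∀ v, rootEval G a c S t v = rootEval G' a' c S t (e v) :=
    fun c S t ht v => congrFun (he v) (c, S, ⟨t, ht⟩)
  have hroot : ∀ c S v, RootOK G c S a v ↔ RootOK G' c S a' (e v) := by
    intro c S v
    rw [← rootEval_pos_iff, he c S nil (Nat.zero_le _) v, rootEval_pos_iff]
  have hcol : ∀ v, G'.color (e v) = G.color v := fun v => ((hroot (G.color v) ∅ v).1 ⟨rfl, by simp⟩).1
  have hadj : ∀ v i, G.graph.Adj v (a i) ↔ G'.graph.Adj (e v) (a' i) := by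
    intro v i
    simpa [RootOK, hcol] using hroot (G.color v) {i} v
  have heq : ∀ v i, v = a i ↔ e v = a' i := fun v i => by rw [← hea i, e.apply_eq_iff_eq]
  refine ⟨e, fun v => ⟨?_, ?_, ?_, fun t ht => ?_⟩⟩
  · simp only [Fin.forall_fin_succ', tupleSnoc_castSucc, tupleSnoc_last, heq, hea,
      eq_comm (b := v), eq_comm (b := e v), implies_true, and_self]
  · simp only [Fin.forall_fin_succ', tupleSnoc_castSucc, tupleSnoc_last, hadj, hea,
      G.graph.adj_comm _ v, G'.graph.adj_comm _ (e v), implies_true, and_self,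
      SimpleGraph.irrefl]
  · simp only [Fin.forall_fin_succ', tupleSnoc_castSucc, tupleSnoc_last, h.color_eq, hcol,
      implies_true, and_self]
  -- With no required neighbours and the colour of `v`, the root contribution is the term's value at
  -- the extended tuple.
  · have h1 : RootOK G (G.color v) ∅ a v := ⟨rfl, by simp⟩
    have h2 := he (G.color v) ∅ t ht v
    rwa [rootEval, rootEval, if_pos h1, if_pos ((hroot _ _ _).1 h1)] at h2

theorem TermEquiv.sat_iff [Finite Γ] {n : ℕ} (φ : CFormula Γ n) : ∀ {k : ℕ} {a : Fin n → V}
    {a' : Fin n → V'}, φ.qr ≤ k → TermEquiv G G' k a a' → (φ.Sat G a ↔ φ.Sat G' a') := by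
  induction φ with
  | eq x y => exact fun _ h => h.eq_iff x y
  | adj x y => exact fun _ h => h.adj_iff x y
  | hasColor x c => intro k a a' _ h; simp only [CFormula.Sat, h.color_eq]
  | neg φ ih => exact fun hk h => not_congr (ih hk h)
  | or φ ψ ih1 ih2 =>
    exact fun hk h => or_congr (ih1 ((le_max_left _ _).trans hk) h) (ih2 ((le_max_right _ _).trans hk) h)
  | atLeast p φ ih =>
    intro k a a' hk h
    obtain ⟨k, rfl⟩ : ∃ k', k = k' + 1 :=
      Nat.exists_eq_succ_of_ne_zero fun h => by simp [h, CFormula.qr] at hk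
    obtain ⟨e, he⟩ := h.exists_equiv
    rw [CFormula.sat_atLeast_iff, CFormula.sat_atLeast_iff]
    rw [Nat.card_congr (e.subtypeEquiv (q := fun v => φ.Sat G' (tupleSnoc a' v)) fun v => ih (Nat.le_of_succ_le_succ hk) (he v))]

theorem cEquiv_of_eval_eq [Finite Γ] {k : ℕ} (h : ∀ t : ElimTerm Γ 0, t.depth ≤ k →
    t.eval G Fin.elim0 = t.eval G' Fin.elim0) : CEquiv k G G' :=
  fun φ hφ => TermEquiv.sat_iff φ hφ
    ⟨fun i => i.elim0, fun i => i.elim0, fun i => i.elim0, h⟩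

end ElimTerm

/-! ### Locality in graphs of bounded degree -/

namespace ColGraph

variable {Γ V : Type*}

/-- The vertices `u` and `v` have distance at most `r`. -/
def Near (G : ColGraph Γ V) (r : ℕ) (u v : V) : Prop :=
  ∃ p : G.graph.Walk u v, p.length ≤ r

variable {G : ColGraph Γ V} {r s : ℕ} {u v w : V}

theorem Near.symm (h : G.Near r u v) : G.Near r v u := by
  obtain ⟨p, hp⟩ := h
  exact ⟨p.reverse, by rwa [SimpleGraph.Walk.length_reverse]⟩

theorem Near.trans (h : G.Near r u v) (h' : G.Near s v w) : G.Near (r + s) u w := by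
  obtain ⟨p, hp⟩ := h
  obtain ⟨q, hq⟩ := h'
  exact ⟨p.append q, by rw [SimpleGraph.Walk.length_append]; omega⟩

theorem Near.mono (h : G.Near r u v) (hrs : r ≤ s) : G.Near s u v :=
  h.imp fun _ hp => hp.trans hrs

theorem Near.of_adj (h : G.graph.Adj u v) : G.Near 1 u v := ⟨h.toWalk, le_rfl⟩

open Classical in
theorem card_near_le [Fintype V] {d : ℕ} (hG : G.MaxDegreeLE d) (r : ℕ) (u : V) :
    (Finset.univ.filter (G.Near r u)).card ≤ (d + 1) ^ r := by
  induction r generalizing u with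
  | zero =>
    rw [pow_zero, Finset.card_le_one]
    have : ∀ v, G.Near 0 u v → u = v := fun v ⟨p, hp⟩ =>
      SimpleGraph.Walk.eq_of_length_eq_zero (Nat.le_zero.1 hp)
    intro v hv w hw
    rw [← this v (Finset.mem_filter.1 hv).2, ← this w (Finset.mem_filter.1 hw).2]
  | succ r ih =>
    have hsub : Finset.univ.filter (G.Near (r + 1) u) ⊆
        (insert u (Finset.univ.filter (G.graph.Adj u))).biUnion
          fun w => Finset.univ.filter (G.Near r w) := by
      intro v hv
      obtain ⟨p, hp⟩ := (Finset.mem_filter.1 hv).2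
      simp only [Finset.mem_biUnion, Finset.mem_insert, Finset.mem_filter, Finset.mem_univ,
        true_and]
      cases p with
      | nil => exact ⟨u, Or.inl rfl, .nil, Nat.zero_le _⟩
      | cons h p => exact ⟨_, Or.inr h, p, Nat.le_of_succ_le_succ hp⟩
    have hcard : (insert u (Finset.univ.filter (G.graph.Adj u))).card ≤ d + 1 := by
      refine (Finset.card_insert_le _ _).trans (Nat.succ_le_succ ?_)
      have h := hG u
      rw [show G.graph.neighborSet u = ↑(Finset.univ.filter (G.graph.Adj u)) by ext; simp,
        Set.encard_coe_eq_coe_finsetCard] at h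
      exact_mod_cast h
    calc _ ≤ _ := Finset.card_le_card hsub
      _ ≤ _ := Finset.card_biUnion_le_card_mul _ _ _ fun w _ => ih w
      _ ≤ (d + 1) * (d + 1) ^ r := Nat.mul_le_mul_right _ hcard
      _ = _ := (pow_succ' _ _).symm

end ColGraph

namespace ElimTerm

open ColGraph

variable {Γ V : Type*} [Fintype V] {G : ColGraph Γ V}

/-- A nonzero value supplies images of the roots. By induction the image of a root is within `2 ^
t.depth` of every label its tree mentions, so two labels of one tree are at most twice that far
apart; hence the power of two. -/
theorem near_of_eval_ne_zero {n : ℕ} (t : ElimTerm Γ n) : ∀ {i j : Fin n} {a : Fin n → V},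
    t.Conn → t.AllMention j → t.Mentions i → t.eval G a ≠ 0 →
      G.Near (2 ^ t.depth) (a i) (a j) := by
  induction t with
  | nil => exact fun _ _ h => h.elim
  | cons c S t u iht ihu =>
    intro i j a hc hj hi he
    simp only [eval, ne_eq, mul_eq_zero, not_or] at he
    obtain ⟨x, -, hx⟩ := Finset.exists_ne_zero_of_sum_ne_zero he.1
    rw [ite_ne_right_iff] at hx
    have key : ∀ l, l ∈ S ∨ t.Mentions l.castSucc → G.Near (2 ^ t.depth) (a l) x := by
      rintro l (hl | hl)
      · exact (Near.of_adj (hx.1.2 l hl).symm).mono Nat.one_le_two_pow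
      · simpa only [tupleSnoc_castSucc, tupleSnoc_last] using iht hc.1.1 hc.1.2 hl hx.2
    rcases hi with hi | hi
    · refine ((key i hi).trans (key j hj.1).symm).mono ?_
      rw [← two_mul, ← pow_succ']
      exact Nat.pow_le_pow_right two_pos (le_max_left _ _)
    · exact (ihu hc.2 hj.2 hi he.2).mono (Nat.pow_le_pow_right two_pos (le_max_right _ _))

theorem near_root {n : ℕ} {c : Γ} {S : Finset (Fin n)} {t : ElimTerm Γ (n + 1)}
    (ht : t.Conn ∧ t.AllMention (Fin.last n)) {a : Fin n → V} {x : V} (hx : RootOK G c S a x)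
    (he : t.eval G (tupleSnoc a x) ≠ 0) {l : Fin n} (hl : l ∈ S ∨ t.Mentions l.castSucc) :
    G.Near (2 ^ t.depth) (a l) x := by
  rcases hl with hl | hl
  · exact (Near.of_adj (hx.2 l hl).symm).mono Nat.one_le_two_pow
  · simpa only [tupleSnoc_castSucc, tupleSnoc_last] using near_of_eval_ne_zero t ht.1 ht.2 hl he

/-- The values of a connected term are bounded in terms of the maximum degree. -/
theorem eval_le {d k : ℕ} (hG : G.MaxDegreeLE d) {n : ℕ} (t : ElimTerm Γ n) :
    ∀ {j : Fin n} {a : Fin n → V}, t.depth ≤ k → t.Conn → t.AllMention j →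
      t.eval G a ≤ ((d + 1) ^ 2 ^ k) ^ t.size := by
  classical
  induction t with
  | nil => intros; simp [eval, size]
  | cons c S t u iht ihu =>
    intro j a hk hc hj
    simp only [depth, sup_le_iff] at hk
    have h1 : (∑ v, if RootOK G c S a v then t.eval G (tupleSnoc a v) else 0) ≤
        (d + 1) ^ 2 ^ k * ((d + 1) ^ 2 ^ k) ^ t.size := by
      -- Only roots in the ball around `a j` contribute; below a root, the root itself is the new
      -- anchor.
      calc _ ≤ ∑ v, if G.Near (2 ^ k) (a j) v then ((d + 1) ^ 2 ^ k) ^ t.size else 0 := by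
            refine Finset.sum_le_sum fun v _ => ?_
            split_ifs with hv hn hn
            · exact iht (by omega) hc.1.1 hc.1.2
            · refine Nat.le_zero.2 (by_contra fun he => hn ?_)
              exact (near_root hc.1 hv he hj.1).mono (Nat.pow_le_pow_right two_pos (by omega))
            · exact Nat.zero_le _
            · exact le_rfl
        _ = (Finset.univ.filter (G.Near (2 ^ k) (a j))).card * ((d + 1) ^ 2 ^ k) ^ t.size := by
            rw [← Finset.sum_filter, Finset.sum_const, smul_eq_mul]
        _ ≤ _ := Nat.mul_le_mul_right _ (card_near_le hG _ _)
    calc _ ≤ (d + 1) ^ 2 ^ k * ((d + 1) ^ 2 ^ k) ^ t.size * ((d + 1) ^ 2 ^ k) ^ u.size :=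
          Nat.mul_le_mul h1 (ihu hk.2 hc.2 hj.2)
      _ = _ := by simp only [size]; ring

end ElimTerm

/-! ### Reduction to terms of bounded size -/

/-- The monic polynomial `X(X-1)⋯(X-C)` annihilates `h` and lowers large exponents. Positive
exponents stay positive, so that no factor, and no label it mentions, is lost when terms are
rebuilt. -/
theorem pow_mem_span_of_bounded {X : Type*} (C : ℕ) (h : X → ℚ)
    (hC : ∀ x, ∃ m : ℕ, m ≤ C ∧ h x = m) (e : ℕ) :
    h ^ e ∈ Submodule.span ℚ {f | ∃ e' ≤ C, (e' = 0 ↔ e = 0) ∧ f = h ^ e'} := by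
  induction e using Nat.strong_induction_on with
  | _ e ih =>
    rcases le_or_gt e C with he | he
    · exact Submodule.subset_span ⟨e, he, Iff.rfl, rfl⟩
    obtain ⟨r, rfl⟩ : ∃ r, e = r + (C + 1) := ⟨e - (C + 1), by omega⟩
    let p := descPochhammer ℚ (C + 1)
    have hdeg : p.natDegree = C + 1 := descPochhammer_natDegree _ _
    have hzero : ∀ m : ℕ, m ≤ C → p.eval (m : ℚ) = 0 := fun m hm =>
      descPochhammer_eval_coe_nat_of_lt (Nat.lt_succ_of_le hm)
    have hlead : p.coeff (C + 1) = 1 := by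
      have := (monic_descPochhammer ℚ (C + 1)).leadingCoeff
      rwa [Polynomial.leadingCoeff, hdeg] at this
    -- Without a constant term, the reduction cannot produce exponent `0` when `r = 0`.
    have hcoeff : p.coeff 0 = 0 := by
      rw [Polynomial.coeff_zero_eq_eval_zero]
      exact_mod_cast hzero 0 (Nat.zero_le _)
    have hpow : h ^ (r + (C + 1)) = -∑ i ∈ Finset.range (C + 1), p.coeff i • h ^ (r + i) := by
      funext x
      obtain ⟨m, hm, hx⟩ := hC x
      have := hzero m hm
      rw [Polynomial.eval_eq_sum_range, hdeg, Finset.sum_range_succ, hlead, one_mul] at this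
      have h2 : ∑ i ∈ Finset.range (C + 1), p.coeff i * (m : ℚ) ^ (r + i) =
          (m : ℚ) ^ r * ∑ i ∈ Finset.range (C + 1), p.coeff i * (m : ℚ) ^ i := by
        rw [Finset.mul_sum]
        exact Finset.sum_congr rfl fun i _ => by ring
      simp only [Pi.pow_apply, Pi.neg_apply, Finset.sum_apply, Pi.smul_apply, smul_eq_mul, hx, h2]
      rw [pow_add]
      linear_combination (m : ℚ) ^ r * this
    rw [hpow]
    refine Submodule.neg_mem _ (Submodule.sum_mem _ fun i hi => ?_)
    rcases Nat.eq_zero_or_pos i with rfl | hi0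
    · rw [hcoeff, zero_smul]
      exact Submodule.zero_mem _
    · refine Submodule.smul_mem _ _ (Submodule.span_mono ?_ (ih (r + i) (by
        have := Finset.mem_range.1 hi
        omega)))
      rintro f ⟨e', h1, h2, h3⟩
      exact ⟨e', h1, h2.trans (by omega), h3⟩

theorem prod_pow_mem_span_of_bounded {X ι : Type*} (C : ℕ) (T : Finset ι) (h : ι → X → ℚ)
    (hC : ∀ t ∈ T, ∀ x, ∃ m : ℕ, m ≤ C ∧ h t x = m) (e : ι → ℕ) :
    ∏ t ∈ T, h t ^ e t ∈ Submodule.span ℚ {f | ∃ e' : ι → ℕ, (∀ t ∈ T, e' t ≤ C) ∧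
      (∀ t ∈ T, e' t = 0 ↔ e t = 0) ∧ f = ∏ t ∈ T, h t ^ e' t} := by
  classical
  induction T using Finset.induction_on with
  | empty => exact Submodule.subset_span ⟨0, by simp⟩
  | insert t T ht ih =>
    rw [Finset.prod_insert ht]
    have h1 := pow_mem_span_of_bounded C (h t) (hC t (Finset.mem_insert_self _ _)) (e t)
    have h2 := ih fun u hu => hC u (Finset.mem_insert_of_mem hu)
    have h3 := Submodule.mul_mem_mul h1 h2
    rw [Submodule.span_mul_span] at h3
    refine Submodule.span_mono ?_ h3
    rintro _ ⟨_, ⟨a, ha1, ha2, rfl⟩, _, ⟨e', he1, he2, rfl⟩, rfl⟩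
    have hne : ∀ u ∈ T, u ≠ t := fun u hu h => ht (h ▸ hu)
    refine ⟨Function.update e' t a, ?_, ?_, ?_⟩
    · intro u hu
      rcases Finset.mem_insert.1 hu with rfl | hu
      · simpa
      · rw [Function.update_of_ne (hne u hu)]; exact he1 u hu
    · intro u hu
      rcases Finset.mem_insert.1 hu with rfl | hu
      · simpa
      · rw [Function.update_of_ne (hne u hu)]; exact he2 u hu
    · rw [Finset.prod_insert ht, Function.update_self]
      refine congrArg (_ * ·) (Finset.prod_congr rfl fun u hu => ?_)
      rw [Function.update_of_ne (hne u hu)]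

namespace ElimTerm

variable {Γ V V' : Type*}

/-- A bound for the number of terms of size at most `s` with at most `U - s` labels over `g`
colours. -/
def countBound (g U : ℕ) : ℕ → ℕ
  | 0 => 1
  | s + 1 => g * 2 ^ U * (countBound g U s * countBound g U s) + 1

/-- A bound for the size of the terms of depth at most `j` that are needed to express all terms of
depth at most `j` with at least one and at most `k - j` labels. -/
def sizeBound (g d k : ℕ) : ℕ → ℕ
  | 0 => 0
  | j + 1 => countBound g (k + (sizeBound g d k j + 1)) (sizeBound g d k j + 1) *
      (((d + 1) ^ 2 ^ k) ^ (sizeBound g d k j + 1) * (sizeBound g d k j + 1))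

open Classical in
/-- A finite set of terms that contains all terms of size at most `s`. -/
noncomputable def termsOfSizeLE (Γ : Type*) [Fintype Γ] : ℕ → (n : ℕ) → Finset (ElimTerm Γ n)
  | 0, _ => {nil}
  | s + 1, n => insert nil ((Finset.univ ×ˢ Finset.univ ×ˢ
      termsOfSizeLE Γ s (n + 1) ×ˢ termsOfSizeLE Γ s n).image
        fun p => cons p.1 p.2.1 p.2.2.1 p.2.2.2)

theorem mem_termsOfSizeLE [Fintype Γ] {s n : ℕ} {t : ElimTerm Γ n} (h : t.size ≤ s) :
    t ∈ termsOfSizeLE Γ s n := by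
  classical
  induction s generalizing n with
  | zero =>
    cases t with
    | nil => simp [termsOfSizeLE]
    | cons => simp [size] at h
  | succ s ih =>
    cases t with
    | nil => simp [termsOfSizeLE]
    | cons c S t u =>
      simp only [size] at h
      refine Finset.mem_insert_of_mem (Finset.mem_image.2 ⟨(c, S, t, u), ?_, rfl⟩)
      simp only [Finset.mem_product, Finset.mem_univ, true_and]
      exact ⟨ih (by omega), ih (by omega)⟩

/-- Going below a root adds a label but costs a unit of size, so `n + s` does not grow and `2 ^ U`
bounds the choices of neighbour sets at every level. -/
theorem card_termsOfSizeLE [Fintype Γ] {U s n : ℕ} (h : n + s ≤ U) :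
    (termsOfSizeLE Γ s n).card ≤ countBound (Fintype.card Γ) U s := by
  classical
  induction s generalizing n with
  | zero => simp [termsOfSizeLE, countBound]
  | succ s ih =>
    refine (Finset.card_insert_le _ _).trans (Nat.succ_le_succ (Finset.card_image_le.trans ?_))
    rw [Finset.card_product, Finset.card_product, Finset.card_product, Finset.card_univ,
      Finset.card_univ, Fintype.card_finset, Fintype.card_fin, mul_assoc]
    refine Nat.mul_le_mul_left _ (Nat.mul_le_mul (Nat.pow_le_pow_right two_pos (by omega)) ?_)
    exact Nat.mul_le_mul (ih (by omega)) (ih (by omega))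

section pairEval

variable [Fintype V] [Fintype V']

/-- The values of a term in two graphs. -/
noncomputable def pairEval (G : ColGraph Γ V) (G' : ColGraph Γ V') {n : ℕ} (t : ElimTerm Γ n) :
    (Fin n → V) ⊕ (Fin n → V') → ℚ :=
  Sum.elim (fun a => (t.eval G a : ℚ)) fun a => (t.eval G' a : ℚ)

/-- The linear map that expresses the values of a tree by those of the trees below its root. -/
noncomputable def rootSum (G : ColGraph Γ V) (G' : ColGraph Γ V') {n : ℕ} (c : Γ)
    (S : Finset (Fin n)) :
    ((Fin (n + 1) → V) ⊕ (Fin (n + 1) → V') → ℚ) →ₗ[ℚ] ((Fin n → V) ⊕ (Fin n → V') → ℚ) where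
  toFun F := Sum.elim
    (fun a => ∑ v, if RootOK G c S a v then F (Sum.inl (tupleSnoc a v)) else 0)
    fun a => ∑ v, if RootOK G' c S a v then F (Sum.inr (tupleSnoc a v)) else 0
  map_add' F F' := by
    funext a
    rcases a with a | a <;>
      simp only [Sum.elim_inl, Sum.elim_inr, Pi.add_apply, ← Finset.sum_add_distrib] <;>
      exact Finset.sum_congr rfl fun v _ => by split_ifs <;> simp
  map_smul' r F := by
    funext a
    rcases a with a | a <;>
      simp only [Sum.elim_inl, Sum.elim_inr, Pi.smul_apply, smul_eq_mul, Finset.mul_sum, mul_ite,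
        mul_zero, RingHom.id_apply]

variable {G : ColGraph Γ V} {G' : ColGraph Γ V'} {n : ℕ}

theorem pairEval_nil : pairEval G G' (nil : ElimTerm Γ n) = 1 := by
  funext a
  rcases a with a | a <;> simp [pairEval, eval]

theorem pairEval_append (t u : ElimTerm Γ n) :
    pairEval G G' (t.append u) = pairEval G G' t * pairEval G G' u := by
  funext a
  rcases a with a | a <;> simp [pairEval, eval_append]

theorem pairEval_cons (c : Γ) (S : Finset (Fin n)) (t : ElimTerm Γ (n + 1)) (u : ElimTerm Γ n) :
    pairEval G G' (cons c S t u) = rootSum G G' c S (pairEval G G' t) * pairEval G G' u := by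
  funext a
  rcases a with a | a <;> simp [pairEval, eval, rootSum]

theorem pairEval_cons_nil (c : Γ) (S : Finset (Fin n)) (t : ElimTerm Γ (n + 1)) :
    pairEval G G' (cons c S t nil) = rootSum G G' c S (pairEval G G' t) := by
  rw [pairEval_cons, pairEval_nil, mul_one]

/-- Powers of terms can be multiplied to give a term. -/
theorem exists_pairEval_eq_prod (T : Finset (ElimTerm Γ n)) (e : ElimTerm Γ n → ℕ) (i : Fin n)
    (j : ℕ) (hT : ∀ t ∈ T, t.Conn ∧ t.AllMention i ∧ t.depth ≤ j) :
    ∃ u : ElimTerm Γ n, pairEval G G' u = ∏ t ∈ T, pairEval G G' t ^ e t ∧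
      u.Conn ∧ u.AllMention i ∧ u.depth ≤ j ∧ u.size = ∑ t ∈ T, e t * t.size ∧
      ∀ l, u.Mentions l ↔ ∃ t ∈ T, e t ≠ 0 ∧ t.Mentions l := by
  classical
  have hpow : ∀ t ∈ T, ∀ m : ℕ, ∃ u : ElimTerm Γ n, pairEval G G' u = pairEval G G' t ^ m ∧
      u.Conn ∧ u.AllMention i ∧ u.depth ≤ j ∧ u.size = m * t.size ∧
      ∀ l, u.Mentions l ↔ m ≠ 0 ∧ t.Mentions l := by
    intro t ht m
    obtain ⟨h1, h2, h3⟩ := hT t ht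
    induction m with
    | zero => exact ⟨nil, by simp [pairEval_nil, Conn, AllMention, depth, size, Mentions]⟩
    | succ m ih =>
      obtain ⟨u, g1, g2, g3, g4, g5, g6⟩ := ih
      refine ⟨u.append t, ?_, ?_, ?_, ?_, ?_, ?_⟩
      · rw [pairEval_append, g1, pow_succ]
      · exact (conn_append _ _).2 ⟨g2, h1⟩
      · exact (allMention_append _ _ _).2 ⟨g3, h2⟩
      · rw [depth_append]; exact max_le g4 h3
      · rw [size_append, g5]; ring
      · intro l
        rw [mentions_append, g6]
        simp only [ne_eq, Nat.add_eq_zero_iff, one_ne_zero, and_false, not_false_eq_true, true_and]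
        tauto
  clear hT
  induction T using Finset.induction_on with
  | empty => exact ⟨nil, by simp [pairEval_nil, Conn, AllMention, depth, size, Mentions]⟩
  | insert t T ht ih =>
    obtain ⟨u, h1, h2, h3, h4, h5, h6⟩ := ih fun u hu => hpow u (Finset.mem_insert_of_mem hu)
    obtain ⟨w, g1, g2, g3, g4, g5, g6⟩ := hpow t (Finset.mem_insert_self _ _) (e t)
    refine ⟨w.append u, ?_, ?_, ?_, ?_, ?_, ?_⟩
    · rw [pairEval_append, g1, h1, Finset.prod_insert ht]
    · exact (conn_append _ _).2 ⟨g2, h2⟩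
    · exact (allMention_append _ _ _).2 ⟨g3, h3⟩
    · rw [depth_append]; exact max_le g4 h4
    · rw [size_append, g5, h5, Finset.sum_insert ht]
    · intro l
      rw [mentions_append, g6, h6]
      simp

open Classical in
/-- The factors into which the terms of depth `j + 1` are decomposed. -/
noncomputable def factors (Γ : Type*) [Fintype Γ] {n : ℕ} (i : Fin n) (j s : ℕ) :
    Finset (ElimTerm Γ n) :=
  (termsOfSizeLE Γ s n).filter fun t => t.Conn ∧ t.AllMention i ∧ t.depth ≤ j ∧ t.size ≤ s

theorem mem_factors [Fintype Γ] {i : Fin n} {j s : ℕ} {t : ElimTerm Γ n} :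
    t ∈ factors Γ i j s ↔ t.Conn ∧ t.AllMention i ∧ t.depth ≤ j ∧ t.size ≤ s := by
  classical
  refine Finset.mem_filter.trans ⟨fun h => h.2, fun h => ⟨mem_termsOfSizeLE h.2.2.2, h⟩⟩

variable [Fintype Γ]

/-- The connected terms of bounded size that mention the same labels as `t`. -/
def boundedTerms (i : Fin n) (j s : ℕ) (t : ElimTerm Γ n) : Set (ElimTerm Γ n) :=
  {u | u.Conn ∧ u.AllMention i ∧ u.depth ≤ j ∧ u.size ≤ s ∧ ∀ l, u.Mentions l ↔ t.Mentions l}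

/-- By linearity of `rootSum`, the terms below each root can be replaced by bounded ones. Each tree
then comes from a finite set of factors, and a list of trees is a product of their powers, with
exponents still unbounded. -/
theorem pairEval_mem_span_prod {k j s : ℕ}
    (ih : ∀ (n : ℕ) (i : Fin n) (t : ElimTerm Γ n), n + j ≤ k → t.Conn → t.AllMention i →
      t.depth ≤ j → pairEval G G' t ∈ Submodule.span ℚ (pairEval G G' '' boundedTerms i j s t))
    {n : ℕ} (t : ElimTerm Γ n) : ∀ (i : Fin n), n + (j + 1) ≤ k → t.Conn → t.AllMention i →
      t.depth ≤ j + 1 → pairEval G G' t ∈ Submodule.span ℚ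
        {f | ∃ e : ElimTerm Γ n → ℕ, f = ∏ u ∈ factors Γ i (j + 1) (s + 1), pairEval G G' u ^ e u ∧
          ∀ l, t.Mentions l ↔ ∃ u ∈ factors Γ i (j + 1) (s + 1), e u ≠ 0 ∧ u.Mentions l} := by
  classical
  induction t with
  | nil =>
    intro i _ _ _ _
    exact Submodule.subset_span ⟨0, by simp [pairEval_nil, Mentions]⟩
  | cons c S t u _ ihu =>
    intro i hk hc hi hd
    simp only [depth, sup_le_iff] at hd
    have h1 := ih _ (Fin.last _) t (by omega) hc.1.1 hc.1.2 (by omega)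
    have h2 := Submodule.mem_map_of_mem (f := rootSum G G' c S) h1
    rw [Submodule.map_span] at h2
    have h3 := Submodule.mul_mem_mul h2 (ihu i hk hc.2 hi.2 hd.2)
    rw [Submodule.span_mul_span] at h3
    rw [pairEval_cons]
    refine Submodule.span_mono ?_ h3
    rintro _ ⟨_, ⟨_, ⟨w, ⟨hw1, hw2, hw3, hw4, hw5⟩, rfl⟩, rfl⟩, _, ⟨e, rfl, he⟩, rfl⟩
    have hmem : cons c S w nil ∈ factors Γ i (j + 1) (s + 1) := by
      refine mem_factors.2 ⟨⟨⟨hw1, hw2⟩, trivial⟩, ⟨?_, trivial⟩, ?_, ?_⟩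
      -- The replacement mentions the same labels, so the new tree is still anchored at `i`.
      · rw [hw5]; exact hi.1
      · simp only [depth]; omega
      · simp only [size]; omega
    refine ⟨e + Pi.single (cons c S w nil) 1, ?_, fun l => ?_⟩
    · simp only [Pi.add_apply, pow_add, Finset.prod_mul_distrib]
      rw [mul_comm, ← pairEval_cons_nil]
      congr 1
      rw [Finset.prod_eq_single_of_mem _ hmem (fun b _ hb => by rw [Pi.single_eq_of_ne hb, pow_zero]),
        Pi.single_eq_same, pow_one]
    · rw [Mentions.cons_iff, he, ← hw5]
      constructor
      · rintro (h | ⟨x, hx, hx0, hxl⟩)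
        · exact ⟨_, hmem, by simp, Or.inl h⟩
        · exact ⟨x, hx, by simp [hx0], hxl⟩
      · rintro ⟨x, hx, hx0, hxl⟩
        by_cases hxe : x = cons c S w nil
        · subst hxe
          exact Or.inl (hxl.elim id False.elim)
        · rw [Pi.add_apply, Pi.single_eq_of_ne hxe, add_zero] at hx0
          exact Or.inr ⟨x, hx, hx0, hxl⟩

/-- On graphs of bounded degree, the values of connected terms are linear combinations of those of
connected terms of bounded size. -/
theorem pairEval_mem_span {d k : ℕ} (hG : G.MaxDegreeLE d) (hG' : G'.MaxDegreeLE d) (j : ℕ) :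
    ∀ (n : ℕ) (i : Fin n) (t : ElimTerm Γ n), n + j ≤ k → t.Conn → t.AllMention i →
      t.depth ≤ j → pairEval G G' t ∈ Submodule.span ℚ
        (pairEval G G' '' boundedTerms i j (sizeBound (Fintype.card Γ) d k j) t) := by
  classical
  induction j with
  | zero =>
    intro n i t _ hc hi hd
    cases t with
    | nil => exact Submodule.subset_span ⟨nil, ⟨hc, hi, hd, Nat.zero_le _, fun _ => Iff.rfl⟩, rfl⟩
    | cons => simp [depth] at hd
  | succ j ih =>
    intro n i t hk hc hi hd
    refine Submodule.span_le.2 ?_ (pairEval_mem_span_prod ih t i hk hc hi hd)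
    rintro _ ⟨e, rfl, he⟩
    set s := sizeBound (Fintype.card Γ) d k j with hs
    set T := factors Γ i (j + 1) (s + 1)
    set C := ((d + 1) ^ 2 ^ k) ^ (s + 1)
    -- `eval_le` bounds the factors by `C`, so exponents up to `C` suffice; the size is then at most
    -- the number of factors times `C * (s + 1)`.
    refine Submodule.span_mono ?_ (prod_pow_mem_span_of_bounded C T (pairEval G G') ?_ e)
    · rintro _ ⟨e', he1, he2, rfl⟩
      obtain ⟨u, h1, h2, h3, h4, h5, h6⟩ := exists_pairEval_eq_prod (G := G) (G' := G') T e' i (j + 1)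
        fun t ht => ⟨(mem_factors.1 ht).1, (mem_factors.1 ht).2.1, (mem_factors.1 ht).2.2.1⟩
      refine ⟨u, ⟨h2, h3, h4, ?_, fun l => ?_⟩, h1⟩
      · calc u.size ≤ ∑ t ∈ T, C * (s + 1) := by
              rw [h5]
              exact Finset.sum_le_sum fun t ht =>
                Nat.mul_le_mul (he1 t ht) (mem_factors.1 ht).2.2.2
          _ = T.card * (C * (s + 1)) := by rw [Finset.sum_const, smul_eq_mul]
          _ ≤ _ := Nat.mul_le_mul_right _ ((Finset.card_filter_le _ _).trans
              (card_termsOfSizeLE (by omega)))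
      · rw [h6, he]
        refine exists_congr fun x => and_congr_right fun hx => ?_
        rw [ne_eq, he2 x hx]
    · intro u hu
      obtain ⟨h1, h2, h3, h4⟩ := mem_factors.1 hu
      have hC : ((d + 1) ^ 2 ^ k) ^ u.size ≤ C := Nat.pow_le_pow_right (by positivity) h4
      rintro (a | a)
      · exact ⟨_, (eval_le hG u (by omega) h1 h2).trans hC, rfl⟩
      · exact ⟨_, (eval_le hG' u (by omega) h1 h2).trans hC, rfl⟩

/-- In graphs of bounded degree, the values of all closed terms are determined by those of bounded
size. -/
theorem eval_eq_of_bounded {d k : ℕ} (hG : G.MaxDegreeLE d) (hG' : G'.MaxDegreeLE d)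
    (h : ∀ t : ElimTerm Γ 0, t.depth ≤ k → t.size ≤ sizeBound (Fintype.card Γ) d k (k - 1) + 1 →
      t.eval G Fin.elim0 = t.eval G' Fin.elim0) (t : ElimTerm Γ 0) (ht : t.depth ≤ k) :
    t.eval G Fin.elim0 = t.eval G' Fin.elim0 := by
  have main : ∀ {n : ℕ} (p : ElimTerm Γ n), n = 0 → p.Conn → p.depth ≤ k →
      ∀ (a : Fin n → V) (a' : Fin n → V'), p.eval G a = p.eval G' a' := by
    intro n p
    induction p with
    | nil => intros; rfl
    | cons c S t u _ ihu =>
      rintro rfl hc hd a a'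
      simp only [depth, sup_le_iff] at hd
      -- Below a root of a closed term, the root is the only label and serves as the anchor, leaving
      -- depth `k - 1`.
      have hspan := pairEval_mem_span (k := k) hG hG' (k - 1) 1 (Fin.last 0) t (by omega) hc.1.1 hc.1.2
        (by omega)
      -- Working with functions on both graphs at once makes the same coefficients valid for both,
      -- so equality on the generators extends linearly.
      have hroot : ∀ F ∈ Submodule.span ℚ (pairEval G G' '' boundedTerms (Fin.last 0) (k - 1)
          (sizeBound (Fintype.card Γ) d k (k - 1)) t),
          rootSum G G' c S F (Sum.inl a) = rootSum G G' c S F (Sum.inr a') := by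
        intro F hF
        induction hF using Submodule.span_induction with
        | mem F hF =>
          obtain ⟨w, ⟨-, -, hw3, hw4, -⟩, rfl⟩ := hF
          rw [← pairEval_cons_nil, Subsingleton.elim a Fin.elim0, Subsingleton.elim a' Fin.elim0]
          refine congrArg Nat.cast (h _ ?_ ?_)
          · simp only [depth]; omega
          · simp only [size]; omega
        | zero => simp
        | add F F' _ _ h1 h2 => simp only [map_add, Pi.add_apply, h1, h2]
        | smul r F _ h1 => simp only [map_smul, Pi.smul_apply, h1]
      have h1 := hroot _ hspan
      rw [← pairEval_cons_nil] at h1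
      have h2 : (cons c S t nil).eval G a = (cons c S t nil).eval G' a' := Nat.cast_injective h1
      simp only [eval, mul_one] at h2
      simp only [eval, h2, ihu rfl hc.2 hd.2 a a']
  obtain ⟨p, hpc, hpd, hp, hp'⟩ := exists_conn G G' t
  rw [hp, hp']
  exact main p rfl hpc (hpd.trans ht) _ _

end pairEval

end ElimTerm

/-! ### Codes of graphs with elimination forests -/

/-- The vertex `p.1` is a proper ancestor of `p.2` in the forest whose vertices, listed in preorder,
have the given levels. -/
def IsAncestor (lvl : List ℕ) (p : ℕ × ℕ) : Prop :=
  p.1 < p.2 ∧ ∀ x < p.2 + 1, p.1 < x → lvl.getD p.1 0 < lvl.getD x 0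

instance (lvl : List ℕ) : DecidablePred (IsAncestor lvl) := fun p => by
  unfold IsAncestor; infer_instance

theorem IsAncestor.trans {lvl : List ℕ} {u v w : ℕ} (h : IsAncestor lvl (u, v))
    (h' : IsAncestor lvl (v, w)) : IsAncestor lvl (u, w) := by
  refine ⟨h.1.trans h'.1, fun x hx hux => ?_⟩
  rcases le_or_gt x v with hxv | hxv
  · exact h.2 x (Nat.lt_succ_of_le hxv) hux
  · exact (h.2 v (Nat.lt_succ_self _) h.1).trans (h'.2 x hx hxv)

/-- The lists of length at most `n` with entries from `l`. -/
def listsUpTo {α : Type*} (l : List α) : ℕ → List (List α)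
  | 0 => [[]]
  | n + 1 => [] :: l.flatMap fun a => (listsUpTo l n).map (List.cons a)

theorem mem_listsUpTo {α : Type*} {l x : List α} {n : ℕ} (hx : x.length ≤ n) (hl : ∀ a ∈ x, a ∈ l) :
    x ∈ listsUpTo l n := by
  induction n generalizing x with
  | zero => simpa [listsUpTo] using hx
  | succ n ih =>
    cases x with
    | nil => simp [listsUpTo]
    | cons a x =>
      refine List.mem_cons_of_mem _ (List.mem_flatMap.2 ⟨a, hl a (by simp), List.mem_map.2 ⟨x, ?_, rfl⟩⟩)
      exact ih (Nat.le_of_succ_le_succ hx) fun b hb => hl b (by simp [hb])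

theorem of_mem_listsUpTo {α : Type*} {l x : List α} {n : ℕ} (hx : x ∈ listsUpTo l n) :
    ∀ a ∈ x, a ∈ l := by
  induction n generalizing x with
  | zero => simp_all [listsUpTo]
  | succ n ih =>
    rcases List.mem_cons.1 hx with rfl | hx
    · simp
    · obtain ⟨a, ha, hx⟩ := List.mem_flatMap.1 hx
      obtain ⟨y, hy, rfl⟩ := List.mem_map.1 hx
      intro b hb
      rcases List.mem_cons.1 hb with rfl | hb
      · exact ha
      · exact ih hy b hb

namespace GraphCode

/-- The pairs of numbers less than `n`. -/
def pairs (n : ℕ) : List (ℕ × ℕ) :=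
  (List.range n).flatMap fun i => (List.range n).map fun j => (i, j)

/-- Codes of graphs with at most `N` vertices with elimination forests of height at most `k`. -/
def elimCodes {Γ : Type*} (colors : List Γ) (k N : ℕ) : List (GraphCode Γ) :=
  (listsUpTo colors N).flatMap fun cols => (listsUpTo (List.range k) N).flatMap fun lvl =>
    (listsUpTo (pairs N) (N * N)).map fun prs => (cols, prs.filter fun p => IsAncestor lvl p)

variable {Γ : Type*}

theorem mem_elimCodes {colors : List Γ} {k N : ℕ} {C : GraphCode Γ} :
    C ∈ elimCodes colors k N ↔ ∃ cols ∈ listsUpTo colors N, ∃ lvl ∈ listsUpTo (List.range k) N,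
      ∃ prs ∈ listsUpTo (pairs N) (N * N), (cols, prs.filter fun p => IsAncestor lvl p) = C := by
  simp only [elimCodes, List.mem_flatMap, List.mem_map]

/-- The forest order given by the levels of the vertices in preorder. -/
abbrev levelOrder (lvl : List ℕ) (n : ℕ) : PartialOrder (Fin n) where
  le u w := u = w ∨ IsAncestor lvl (u, w)
  lt u w := (u = w ∨ IsAncestor lvl (u, w)) ∧ ¬ (w = u ∨ IsAncestor lvl (w, u))
  lt_iff_le_not_ge _ _ := Iff.rfl
  le_refl u := Or.inl rfl
  le_trans u v w := by
    rintro (rfl | h) (rfl | h')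
    · exact Or.inl rfl
    · exact Or.inr h'
    · exact Or.inr h
    · exact Or.inr (h.trans h')
  le_antisymm u w := by
    rintro (rfl | h) (h' | h')
    · rfl
    · rfl
    · exact h'.symm
    · exact absurd h.1 h'.1.le.not_gt

/-- Any list of levels defines a forest order, and the filter retains only edges between comparable
vertices. Levels increase strictly along chains and are less than `k`. -/
theorem decode_mem_TD {colors : List Γ} {k N : ℕ} (hk : 1 ≤ k) {C : GraphCode Γ}
    (hC : C ∈ elimCodes colors k N) : C.decode ∈ TD Γ k := by
  obtain ⟨cols, -, lvl, hlvl, prs, -, rfl⟩ := mem_elimCodes.1 hC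
  have hlt : ∀ x, lvl.getD x 0 < k := by
    intro x
    rw [List.getD_eq_getElem?_getD]
    rcases h : lvl[x]? with _ | y
    -- A vertex beyond the end of the list has default level `0`, which is less than `k` only
    -- because `k` is positive.
    · exact hk
    · exact List.mem_range.1 (of_mem_listsUpTo hlvl y (List.mem_of_getElem? h))
  have hforest : IsElimForest (decode (cols, prs.filter fun p => IsAncestor lvl p)).2.graph
      (levelOrder lvl cols.length) := by
    constructor
    -- The descendants of a vertex form an interval in preorder, so of two ancestors of `t` the
    -- earlier one is an ancestor of the later.
    · have key : ∀ u w t : Fin cols.length, IsAncestor lvl (u, t) → w ≤ t → u < w →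
          IsAncestor lvl (u, w) := fun u w t h hw huw =>
        ⟨huw, fun x hx => h.2 x (lt_of_lt_of_le hx (Nat.succ_le_succ hw))⟩
      intro t u hu w hw huw
      have hle : ∀ x : Fin cols.length, (x = t ∨ IsAncestor lvl (x, t)) → x ≤ t := by
        rintro x (rfl | h)
        · exact le_rfl
        · exact h.1.le
      rcases lt_or_gt_of_ne huw with h | h
      · rcases hu with rfl | hu
        · exact absurd (hle w hw) (not_le.2 h)
        · exact Or.inl (Or.inr (key u w t hu (hle w hw) h))
      · rcases hw with rfl | hw
        · exact absurd (hle u hu) (not_le.2 h)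
        · exact Or.inr (Or.inr (key w u t hw (hle u hu) h))
    · rintro u w ⟨-, h | h⟩
      · exact Or.inl (Or.inr (of_decide_eq_true (List.mem_filter.1 h).2))
      · exact Or.inr (Or.inr (of_decide_eq_true (List.mem_filter.1 h).2))
  refine (iInf₂_le (f := fun S _ => forestHeight S) (levelOrder lvl cols.length) hforest).trans (iSup₂_le fun X hX => ?_)
  have hinj : Set.InjOn (fun u : Fin cols.length => lvl.getD u 0) X := by
    intro u hu w hw huw
    by_contra hne
    rcases hX hu hw hne with (h | h) | (h | h)
    · exact hne h
    · exact (h.2 w (Nat.lt_succ_self _) h.1).ne huw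
    · exact hne h.symm
    · exact (h.2 u (Nat.lt_succ_self _) h.1).ne huw.symm
  rw [← hinj.encard_image]
  calc _ ≤ ((Finset.range k : Set ℕ)).encard := Set.encard_le_encard (by
        rintro _ ⟨u, -, rfl⟩
        simpa using hlt u)
    _ = k := by rw [Set.encard_coe_eq_coe_finsetCard, Finset.card_range]

end GraphCode

/-! ### From terms to codes -/

namespace ElimTerm

open LabelledGraph

variable {Γ V V' : Type*} [Fintype V] [Fintype V']

/-- The graph of a term, with the levels of its vertices and their positions in preorder. -/
theorem exists_labelledGraph (G : ColGraph Γ V) (G' : ColGraph Γ V') {n : ℕ} (t : ElimTerm Γ n) :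
    ∃ (W : Type) (_ : Fintype W) (F : LabelledGraph Γ n W) (lvl pos : W → ℕ),
      Fintype.card W = t.size ∧ Function.Injective pos ∧ (∀ w, pos w < t.size) ∧
      (∀ w, n ≤ lvl w ∧ lvl w < n + t.depth) ∧
      (∀ u w, F.graph.Adj u w → pos u < pos w → ∀ x, pos u < pos x → pos x ≤ pos w →
        lvl u < lvl x) ∧
      (∀ a, Nat.card (F.Homs G a) = t.eval G a) ∧ ∀ a, Nat.card (F.Homs G' a) = t.eval G' a := by
  induction t with
  | nil =>
    exact ⟨Empty, inferInstance, ⟨⟨⊥, Empty.elim⟩, Empty.elim⟩, Empty.elim, Empty.elim, rfl,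
      fun u => u.elim, fun u => u.elim, fun u => u.elim, fun u => u.elim,
      fun a => card_homs_of_isEmpty _ _ _, fun a => card_homs_of_isEmpty _ _ _⟩
  | @cons n c S t u iht ihu =>
    obtain ⟨W₁, _, F₁, lvl₁, pos₁, hc₁, hi₁, hp₁, hl₁, ha₁, hG₁, hG₁'⟩ := iht
    obtain ⟨W₂, _, F₂, lvl₂, pos₂, hc₂, hi₂, hp₂, hl₂, ha₂, hG₂, hG₂'⟩ := ihu
    -- The root has position `0` and level `n`; the trees below it follow, then the remaining trees.
    -- Having `n + 1` labels, the former automatically get levels above `n`.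
    refine ⟨Option (W₁ ⊕ W₂), inferInstance, LabelledGraph.cons c S F₁ F₂,
      fun w => w.elim n (Sum.elim lvl₁ lvl₂),
      fun w => w.elim 0 (Sum.elim (fun w => pos₁ w + 1) fun w => pos₂ w + t.size + 1),
      ?_, ?_, ?_, ?_, ?_, ?_, ?_⟩
    · simp [hc₁, hc₂, size]
    · rintro (_ | v | v) (_ | w | w) h <;> simp only [Option.elim, Sum.elim_inl, Sum.elim_inr] at h
      · rfl
      · omega
      · omega
      · omega
      · rw [hi₁ (Nat.succ_injective h)]
      · have := hp₁ v; omega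
      · omega
      · have := hp₁ w; omega
      · rw [hi₂ (by omega : pos₂ v = pos₂ w)]
    · rintro (_ | w | w) <;> simp only [Option.elim, Sum.elim_inl, Sum.elim_inr, size]
      · omega
      · have := hp₁ w; omega
      · have := hp₂ w; omega
    · rintro (_ | w | w) <;> simp only [Option.elim, Sum.elim_inl, Sum.elim_inr, depth]
      · omega
      · have := hl₁ w; omega
      · have := hl₂ w; omega
    · rintro (_ | v | v) (_ | w | w) hvw h (_ | x | x) h1 h2 <;>
        simp only [Option.elim, Sum.elim_inl, Sum.elim_inr] at h h1 h2 ⊢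
      all_goals first | exact hvw.elim | skip
      all_goals first | omega | skip
      · have := hl₁ x; omega
      · have := hp₁ w; omega
      · exact ha₁ v w hvw (by omega) x (by omega) (by omega)
      · have := hp₁ w; omega
      · have := hp₁ x; omega
      · exact ha₂ v w hvw (by omega) x (by omega) (by omega)
    · intro a
      simp only [card_homs_cons, eval, hG₁, hG₂]
    · intro a
      simp only [card_homs_cons, eval, hG₁', hG₂']

/-- The graph of a term has a code. -/
theorem exists_code (G : ColGraph Γ V) (G' : ColGraph Γ V') (t : ElimTerm Γ 0) {k N : ℕ}
    (hk : t.depth ≤ k) (hN : t.size ≤ N) {colors : List Γ} (hcol : ∀ c, c ∈ colors) :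
    ∃ C ∈ GraphCode.elimCodes colors k N, C.decode.2.homCount G = t.eval G Fin.elim0 ∧
      C.decode.2.homCount G' = t.eval G' Fin.elim0 := by
  classical
  obtain ⟨W, _, F, lvl, pos, hc, hi, hp, hl, ha, hG, hG'⟩ := exists_labelledGraph G G' t
  obtain ⟨σ, hσ⟩ : ∃ σ : W ≃ Fin t.size, ∀ w, (σ w : ℕ) = pos w :=
    ⟨Equiv.ofBijective (fun w => (⟨pos w, hp w⟩ : Fin t.size))
      ((Fintype.bijective_iff_injective_and_card _).2
        ⟨fun u w h => hi (congrArg Fin.val h), by simpa using hc⟩), fun w => rfl⟩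
  let cols := List.ofFn fun i => F.color (σ.symm i)
  let lvls := List.ofFn fun i => lvl (σ.symm i)
  let prs := ((Finset.univ.filter fun p : W × W => F.graph.Adj p.1 p.2).image
    fun p => (pos p.1, pos p.2)).toList
  have hlen : cols.length = t.size := List.length_ofFn
  have hget : ∀ w, lvls.getD (pos w) 0 = lvl w := by
    intro w
    simp [lvls, List.getD_eq_getElem?_getD, ← hσ]
  have hprs : ∀ i j, (i, j) ∈ prs ↔ ∃ u w, F.graph.Adj u w ∧ pos u = i ∧ pos w = j := by
    intro i j
    simp [prs]
  have hanc : ∀ u w, F.graph.Adj u w → pos u < pos w → IsAncestor lvls (pos u, pos w) := by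
    intro u w huw h
    refine ⟨h, fun x hx hux => ?_⟩
    have hxt : x < t.size := lt_of_lt_of_le hx (hp w)
    have hx' : pos (σ.symm ⟨x, hxt⟩) = x := by rw [← hσ]; simp
    have := ha u w huw h (σ.symm ⟨x, hxt⟩) (by omega) (by omega)
    rw [← hget, ← hget, hx'] at this
    exact this
  refine ⟨(cols, prs.filter fun p => IsAncestor lvls p), ?_, ?_⟩
  · refine GraphCode.mem_elimCodes.2 ⟨cols, mem_listsUpTo (hlen.trans_le hN) fun c _ => hcol c, lvls,
      mem_listsUpTo (by simpa [lvls] using hN) ?_, prs, mem_listsUpTo ?_ ?_, rfl⟩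
    · intro x hx
      obtain ⟨i, rfl⟩ := List.mem_ofFn.1 hx
      have := hl (σ.symm i)
      exact List.mem_range.2 (by omega)
    · rw [Finset.length_toList]
      refine Finset.card_image_le.trans ((Finset.card_le_univ _).trans ?_)
      rw [Fintype.card_prod, hc]
      exact Nat.mul_le_mul hN hN
    · rintro ⟨i, j⟩ h
      obtain ⟨u, w, -, rfl, rfl⟩ := (hprs i j).1 h
      simp only [GraphCode.pairs, List.mem_flatMap, List.mem_map, List.mem_range]
      exact ⟨pos u, (hp u).trans_le hN, pos w, (hp w).trans_le hN, rfl⟩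
  -- `prs` contains each edge in both directions; the filter removes just the reversed copy, which
  -- decoding restores by symmetry.
  · have hadj : ∀ u w, ((pos u, pos w) ∈ prs.filter fun p => IsAncestor lvls p) ↔
        F.graph.Adj u w ∧ pos u < pos w := by
      intro u w
      rw [List.mem_filter, hprs, decide_eq_true_iff]
      constructor
      · rintro ⟨⟨u', w', h, h1, h2⟩, h3⟩
        rw [hi h1, hi h2] at h
        exact ⟨h, h3.1⟩
      · rintro ⟨h, h1⟩
        exact ⟨⟨u, w, h, rfl, rfl⟩, hanc u w h h1⟩
    let e : W ≃ Fin cols.length := σ.trans (finCongr hlen.symm)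
    have he : ∀ w, (e w : ℕ) = pos w := fun w => hσ w
    have h1 : ∀ w, (ofColGraph (GraphCode.decode (cols, prs.filter fun p => IsAncestor lvls p)).2).color
        (e w) = F.color w := by
      intro w
      simp [ofColGraph, GraphCode.decode, cols, e]
    have h2 : ∀ u w, (ofColGraph
        (GraphCode.decode (cols, prs.filter fun p => IsAncestor lvls p)).2).graph.Adj (e u) (e w) ↔
          F.graph.Adj u w := by
      intro u w
      have h0 : (ofColGraph (GraphCode.decode (cols, prs.filter fun p => IsAncestor lvls p)).2).graph.Adj
          (e u) (e w) ↔ e u ≠ e w ∧ (((e u : ℕ), (e w : ℕ)) ∈ (prs.filter fun p => IsAncestor lvls p) ∨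
            ((e w : ℕ), (e u : ℕ)) ∈ (prs.filter fun p => IsAncestor lvls p)) := Iff.rfl
      rw [h0, he, he, hadj, hadj, F.graph.adj_comm w u, ← and_or_left, e.injective.ne_iff]
      constructor
      · exact fun h => h.2.1
      · exact fun h => ⟨h.ne, h, lt_or_gt_of_ne (hi.ne h.ne)⟩
    rw [← card_homs_ofColGraph _ G Fin.elim0, ← card_homs_ofColGraph _ G' Fin.elim0, ← hG, ← hG']
    exact ⟨(card_homs_congr e h1 (fun _ => Subsingleton.elim _ _) h2 G _).symm,
      (card_homs_congr e h1 (fun _ => Subsingleton.elim _ _) h2 G' _).symm⟩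

end ElimTerm

/-! ### Primitive recursiveness of the codes and of the size bound -/

section Primrec

open Primrec

theorem primrec_nat_pow : Primrec₂ fun a b : ℕ => a ^ b :=
  Primrec₂.unpaired'.1 Nat.Primrec.pow

theorem primrecRel_isAncestor : PrimrecRel fun (p : ℕ × ℕ) (lvl : List ℕ) => IsAncestor lvl p := by
  have hR : PrimrecRel fun (x : ℕ) (q : (ℕ × ℕ) × List ℕ) =>
      ¬ q.1.1 < x ∨ q.2.getD q.1.1 0 < q.2.getD x 0 := by
    have hp : Primrec fun r : ℕ × (ℕ × ℕ) × List ℕ => r.2.1.1 := fst.comp (fst.comp snd)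
    have hl : Primrec fun r : ℕ × (ℕ × ℕ) × List ℕ => r.2.2 := snd.comp snd
    exact (nat_lt.comp hp fst).not.or
      (nat_lt.comp ((list_getD 0).comp hl hp) ((list_getD 0).comp hl fst))
  refine ((nat_lt.comp (fst.comp fst) (snd.comp fst)).and
    (hR.forall_mem_list.comp (list_range.comp (succ.comp (snd.comp fst))) .id)).of_eq fun q => ?_
  simp only [IsAncestor, List.mem_range, imp_iff_not_or, id]

theorem primrec_listsUpTo {α : Type*} [Primcodable α] :
    Primrec₂ (listsUpTo : List α → ℕ → List (List α)) := by
  have hh : Primrec₂ fun (l : List α) (p : ℕ × List (List α)) =>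
      [] :: l.flatMap fun a => p.2.map (List.cons a) := by
    refine list_cons.comp (.const []) (list_flatMap fst ?_)
    refine list_map (snd.comp (snd.comp fst)) ?_
    exact list_cons.comp (snd.comp fst) snd
  refine (nat_rec (.const [[]]) hh).of_eq fun l n => ?_
  induction n with
  | zero => rfl
  | succ n ih => simp only [listsUpTo, ← ih]

theorem GraphCode.primrec_pairs : Primrec GraphCode.pairs := by
  refine list_flatMap list_range ?_
  refine list_map (list_range.comp fst) ?_
  exact Primrec.pair (snd.comp fst) snd

theorem GraphCode.primrec_elimCodes {Γ : Type*} [Primcodable Γ] (colors : List Γ) :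
    Primrec₂ (GraphCode.elimCodes colors) := by
  refine list_flatMap (primrec_listsUpTo.comp (.const colors) snd) ?_
  refine list_flatMap (primrec_listsUpTo.comp (list_range.comp (fst.comp fst)) (snd.comp fst)) ?_
  have hN : Primrec fun q : ((ℕ × ℕ) × List Γ) × List ℕ => q.1.1.2 := snd.comp (fst.comp fst)
  refine list_map (primrec_listsUpTo.comp (GraphCode.primrec_pairs.comp hN) (nat_mul.comp hN hN)) ?_
  exact Primrec.pair (snd.comp (fst.comp fst)) (primrecRel_isAncestor.listFilter.comp snd (snd.comp fst))

namespace ElimTerm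

theorem primrec_countBound (g : ℕ) : Primrec₂ (countBound g) := by
  have hh : Primrec₂ fun (U : ℕ) (p : ℕ × ℕ) => g * 2 ^ U * (p.2 * p.2) + 1 := by
    have h2 : Primrec fun q : ℕ × ℕ × ℕ => q.2.2 := snd.comp snd
    exact succ.comp (nat_mul.comp (nat_mul.comp (.const g) (primrec_nat_pow.comp (.const 2) fst))
      (nat_mul.comp h2 h2))
  refine (nat_rec (.const 1) hh).of_eq fun U n => ?_
  induction n with
  | zero => rfl
  | succ n ih => simp only [countBound, ← ih]

theorem primrec_sizeBound (g : ℕ) :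
    Primrec₂ fun (p : ℕ × ℕ) (j : ℕ) => sizeBound g p.2 p.1 j := by
  have hh : Primrec₂ fun (p : ℕ × ℕ) (q : ℕ × ℕ) => countBound g (p.1 + (q.2 + 1)) (q.2 + 1) *
      (((p.2 + 1) ^ 2 ^ p.1) ^ (q.2 + 1) * (q.2 + 1)) := by
    have hs : Primrec fun r : (ℕ × ℕ) × ℕ × ℕ => r.2.2 + 1 := succ.comp (snd.comp snd)
    have hk : Primrec fun r : (ℕ × ℕ) × ℕ × ℕ => r.1.1 := fst.comp fst
    have hd : Primrec fun r : (ℕ × ℕ) × ℕ × ℕ => r.1.2 + 1 := succ.comp (snd.comp fst)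
    exact nat_mul.comp ((primrec_countBound g).comp (nat_add.comp hk hs) hs)
      (nat_mul.comp (primrec_nat_pow.comp
        (primrec_nat_pow.comp hd (primrec_nat_pow.comp (.const 2) hk)) hs) hs)
  refine (nat_rec (.const 0) hh).of_eq fun p n => ?_
  induction n with
  | zero => rfl
  | succ n ih => simp only [sizeBound, ← ih]

end ElimTerm

end Primrec

theorem mainTheorem5 {Γ : Type*} [Finite Γ] [Primcodable Γ] :
    ∃ 𝓕 : ℕ → ℕ → Set (FinColGraph Γ), ComputableFamily 𝓕 ∧
      ∀ k d : ℕ, 1 ≤ k → 1 ≤ d →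
        (𝓕 k d).Finite ∧ 𝓕 k d ⊆ TD Γ k ∧
        ∀ (V : Type*) (V' : Type*) [Finite V] [Finite V']
          (G : ColGraph Γ V) (G' : ColGraph Γ V'),
          G.MaxDegreeLE d → G'.MaxDegreeLE d →
            (HomIndistinguishable (𝓕 k d) G G' ↔ CEquiv k G G') := by
  have := Fintype.ofFinite Γ
  -- This list is chosen noncomputably, but it is a constant independent of `k` and `d`, which does
  -- not affect computability.
  let colors : List Γ := Finset.univ.toList
  let L : ℕ → ℕ → List (GraphCode Γ) := fun k d =>
    -- The added `1` counts the root above a bounded term of depth at most `k - 1`.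
    GraphCode.elimCodes colors k (ElimTerm.sizeBound (Fintype.card Γ) d k (k - 1) + 1)
  have hsub : ∀ k d, 1 ≤ k → GraphCode.decode '' {C | C ∈ L k d} ⊆ TD Γ k := by
    rintro k d hk _ ⟨C, hC, rfl⟩
    exact GraphCode.decode_mem_TD hk hC
  refine ⟨fun k d => GraphCode.decode '' {C | C ∈ L k d}, ⟨L, ?_, fun _ _ => rfl⟩,
    fun k d hk _ => ⟨(List.finite_toSet _).image _, hsub k d hk, ?_⟩⟩
  · refine Primrec₂.to_comp ((GraphCode.primrec_elimCodes colors).comp Primrec.fst (Primrec.succ.comp ?_))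
    exact (ElimTerm.primrec_sizeBound (Fintype.card Γ)).comp .id (Primrec.pred.comp Primrec.fst)
  · intro V V' _ _ G G' hG hG'
    have := Fintype.ofFinite V
    have := Fintype.ofFinite V'
    refine ⟨fun h => ?_, fun h A hA => h.homIndistinguishable A (hsub k d hk hA)⟩
    refine ElimTerm.cEquiv_of_eval_eq (ElimTerm.eval_eq_of_bounded hG hG' fun t ht hs => ?_)
    obtain ⟨C, hC, h1, h2⟩ := ElimTerm.exists_code G G' t ht hs
      (colors := colors) fun c => Finset.mem_toList.2 (Finset.mem_univ c)
    rw [← h1, ← h2]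
    exact h _ ⟨C, hC, rfl⟩
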